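/- Let $n\ge 1$ and $N=2^n$, and let $H=H_N$ be the normalized Hadamard matrix, $H_{ij}=N^{-1/2}(-1)^{\langle i,j\rangle}$ for $i,j\in\{0,1\}^n$. For a constant $C$ put $\varepsilon = 1/(C\ln N)$. Let $X\in\mathbb{R}^N$ have independent coordinates $X_i\sim\mathcal N(0,\varepsilon)$, let $Y=HX$, and let $z=(X,\,Y^2-\varepsilon)\in\mathbb{R}^{2N}$, where $Y^2-\varepsilon$ is taken coordinatewise. Let $\operatorname{trnc}(a)=\min(1,\max(-1,a))$. The distribution $\mathcal D$ on $\{\pm1\}^{2N}$ is that of the vector $z'$ obtained by drawing $z$ and then, independently for each $i\in[2N]$, setting $z'_i=1$ with probability $\frac{1+\operatorname{trnc}(z_i)}2$ and $z'_i=-1$ with probability $\frac{1-\operatorname{trnc}(z_i)}2$. For $F:\{\pm1\}^{2N}\to\mathbb{R}$ let $\widehat F(S)=2^{-2N}\sum_{x\in\{\pm1\}^{2N}}F(x)\prod_{i\in S}x_i$ for $S\subseteq[2N]$. Identify $F$ with its multilinear extension $F(z)=\sum_{S\subseteq[2N]}\widehat F(S)\prod_{i\in S}z_i$ to $\mathbb{R}^{2N}$,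 so that $F(0,0)=\widehat F(\emptyset)$ is the average of $F$ over the uniform distribution. Let $L_{1,2}(F)=\sum_{|S|=2}|\widehat F(S)|$. A restriction $\rho\in\{1,-1,*\}^{2N}$ fixes the coordinates with $\rho_i\ne *$ to $\rho_i$ and leaves the others free; $F_\rho$ is the function so obtained from $F$. **Theorem.** There are absolute constants $C_0\ge 20$ and $K>0$ such that for all $C\ge C_0$, all $n\ge1$, all $\ell\ge1$, and all $F:\{\pm1\}^{2N}\to[-1,1]$ (in particular all Boolean $F:\{\pm1\}^{2N}\to\{\pm1\}$) with $L_{1,2}(F_\rho)\le\ell$ for every restriction $\rho$, $$\left|\mathop{\mathbf E}_{(X,Y')\sim\mathcal D}\big[F(X,Y')-F(0,0)\big]\right|\le K\cdot\frac{\varepsilon\,\ell}{\sqrt N}.$$ -/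

import Mathlib

open MeasureTheory ProbabilityTheory
open scoped Matrix

noncomputable section

namespace SquaredForrelation

/-! ### Functions on the cube, Fourier coefficients, restrictions -/

section Cube

variable {ι : Type*} [Fintype ι] [DecidableEq ι]

/-- The Fourier coefficient of `F` at `S`: the average over the cube of `F(x) * ∏_{i ∈ S} x_i`. -/
def cubeFourierCoeff (F : (ι → ℤˣ) → ℝ) (S : Finset ι) : ℝ :=
  (∑ x : ι → ℤˣ, F x * ∏ i ∈ S, (((x i : ℤˣ) : ℤ) : ℝ)) / 2 ^ Fintype.card ι

/-- The multilinear extension of `F` to all real points. -/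
def multilinearExt (F : (ι → ℤˣ) → ℝ) (z : ι → ℝ) : ℝ :=
  ∑ S : Finset ι, cubeFourierCoeff F S * ∏ i ∈ S, z i

/-- The level-two spectral norm: the sum of `|F̂(S)|` over the sets `S` of size two. -/
def levelTwoNorm (F : (ι → ℤˣ) → ℝ) : ℝ :=
  ∑ S ∈ Finset.univ.filter (fun S : Finset ι => S.card = 2), |cubeFourierCoeff F S|

/-- The restriction `F_ρ`: the coordinates `i` with `ρ i = some b` are fixed to `b`, those with
`ρ i = none` stay free. It is kept as a function of all the coordinates; the fixed ones are
ignored, so that the Fourier coefficients at sets meeting them are zero. -/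
def restrict (F : (ι → ℤˣ) → ℝ) (ρ : ι → Option ℤˣ) : (ι → ℤˣ) → ℝ :=
  fun x => F (fun i => (ρ i).getD (x i))

end Cube

/-! ### The distribution -/

/-- Truncation to `[-1, 1]`. -/
def trnc (a : ℝ) : ℝ := min 1 (max (-1) a)

/-- The law on `{±1}` with probability `(1 + trnc a) / 2` of `1`
and probability `(1 - trnc a) / 2` of `-1`. -/
def roundCoord (a : ℝ) : Measure ℤˣ :=
  ENNReal.ofReal ((1 + trnc a) / 2) • Measure.dirac 1 +
    ENNReal.ofReal ((1 - trnc a) / 2) • Measure.dirac (-1)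

instance : MeasurableSingletonClass ℤˣ :=
  ⟨fun u => ⟨{(u : ℤ)}, measurableSet_singleton _, by ext v; simp [Units.ext_iff]⟩⟩

theorem measurable_trnc : Measurable trnc := by
  unfold trnc; fun_prop

instance (a : ℝ) : IsProbabilityMeasure (roundCoord a) := by
  have h1 : trnc a ≤ 1 := min_le_left _ _
  have h2 : -1 ≤ trnc a := le_min (by norm_num) (le_max_left _ _)
  constructor
  simp only [roundCoord, Measure.add_apply, Measure.smul_apply, measure_univ, smul_eq_mul, mul_one]
  rw [← ENNReal.ofReal_add (by linarith) (by linarith)]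
  simp only [ENNReal.ofReal_eq_one]
  ring

theorem measurable_roundCoord_apply (s : Set ℤˣ) : Measurable fun a => roundCoord a s := by
  have h := measurable_trnc
  simp only [roundCoord, Measure.add_apply, Measure.smul_apply, smul_eq_mul]
  fun_prop

theorem measurable_pi_roundCoord {ι : Type*} [Fintype ι] :
    Measurable fun z : ι → ℝ => Measure.pi fun i => roundCoord (z i) := by
  refine Measure.measurable_of_measurable_coe _ fun s hs => ?_
  classical
  have key : ∀ z : ι → ℝ, (Measure.pi fun i => roundCoord (z i)) s =
      ∑ w ∈ s.toFinset, ∏ i, roundCoord (z i) {w i} := by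
    intro z
    rw [← Set.coe_toFinset s, ← sum_measure_singleton]
    simp
  simp only [key]
  refine Finset.measurable_sum _ fun w _ => Finset.measurable_prod _ fun i _ => ?_
  exact (measurable_roundCoord_apply {w i}).comp (measurable_pi_apply i)

/-- Randomized rounding: given `z`, the coordinates are rounded independently. -/
def rounding (ι : Type*) [Fintype ι] : Kernel (ι → ℝ) (ι → ℤˣ) where
  toFun z := Measure.pi fun i => roundCoord (z i)
  measurable' := measurable_pi_roundCoord

/-- The `2 ^ n` indices, as bit strings of length `n`. -/
abbrev Idx (n : ℕ) : Type := Fin n → Bool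

/-- The normalized Hadamard matrix of order `2 ^ n`, with entries `(-1) ^ ⟨x, y⟩ / √(2 ^ n)`. -/
def hadamard (n : ℕ) : Matrix (Idx n) (Idx n) ℝ :=
  Matrix.of fun x y =>
    (-1) ^ (Finset.univ.filter fun k => x k = true ∧ y k = true).card / Real.sqrt (2 ^ n)

/-- `ε = 1 / (C ln N)` with `N = 2 ^ n`. -/
def eps (C : ℝ) (n : ℕ) : ℝ := 1 / (C * Real.log (2 ^ n))

/-- The law of `(X, Y ^ 2 - ε)`, where `X` has independent centred Gaussian coordinates of
variance `ε` and `Y = H X`. -/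
def gaussianLaw (C : ℝ) (n : ℕ) : Measure (Idx n ⊕ Idx n → ℝ) :=
  (Measure.pi fun _ : Idx n => gaussianReal 0 (eps C n).toNNReal).map fun X =>
    Sum.elim X fun i => ((hadamard n *ᵥ X) i) ^ 2 - eps C n

/-- The distribution `𝒟` on `{±1}^{2N}`: draw `z` from `gaussianLaw`, then round it. -/
def forrelationDist (C : ℝ) (n : ℕ) : Measure (Idx n ⊕ Idx n → ℤˣ) :=
  (gaussianLaw C n).bind (rounding (Idx n ⊕ Idx n))

end SquaredForrelation

end

/-! Write `X = s g` with `g` standard Gaussian, and let `s` run from `0` to `√ε`; the endpoint `s =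
0` gives `F(0,0)`. Put `Y = s H g` and `φ(s) = E F(X, Y² - s²)`. Integration by parts shows that in
`φ'` only the mixed derivatives survive: `φ'(s) = 4 s · E ∑ H_{ji} Y_j ∂_{x_i} ∂_{y_j} F`
(`hasDerivAt_integral_driftTerm`). Pairs of the same kind drop out because the coordinates of `g`
are independent, the rows of `H` are orthonormal, and the square is centred. Since `F` is
multilinear, this reduces to an identity for each monomial (`sum_coordDegree_mul_coordMoment`).

When all coordinates of `X` and `Y` are at most `1/2` in absolute value, each mixed derivative is
`4` times the average of a level-two coefficient over a random restriction, so their absolute values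
sum to at most `4ℓ` (`sum_abs_partialExt_le`). With `|H_{ji}| = N^{-1/2}` and `|Y_j| ≤ 1/2`, the sum
in `φ'` is at most `2ℓ/√N`, with no logarithmic loss. Integrating in `s` gives order `ε ℓ / √N`.

The complementary event has probability polynomially small in `N`, with an exponent proportional to
`C`. There `F` and its derivatives are at most `∏ max(1, |z_k|)`, whose contribution is controlled
by Gaussian exponential moments (`abs_integral_le_of_bounds`). The same estimate covers truncation,
which changes nothing on the good event; rounding is exact in expectation by multilinearity
(`integral_rounding`). -/

noncomputable section

namespace SquaredForrelation

/-! ### Multilinear extensions and random restrictions. -/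

section CubeLemmas

variable {ι : Type*} [Fintype ι] [DecidableEq ι]

/-- The mixed partial derivative, in the directions of `R`, of the multilinear extension. -/
def partialExt (F : (ι → ℤˣ) → ℝ) (R : Finset ι) (z : ι → ℝ) : ℝ :=
  ∑ S ∈ Finset.univ.filter (R ⊆ ·), cubeFourierCoeff F S * ∏ i ∈ S \ R, z i

theorem multilinearExt_eq_partialExt (F : (ι → ℤˣ) → ℝ) (z : ι → ℝ) :
    multilinearExt F z = partialExt F ∅ z := by
  simp [multilinearExt, partialExt]

theorem sum_units (f : ℤˣ → ℝ) : ∑ u, f u = f 1 + f (-1) := by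
  rw [show (Finset.univ : Finset ℤˣ) = {1, -1} from rfl]
  rw [Finset.sum_pair (by decide)]

theorem sum_prod_units (f : ι → ℤˣ → ℝ) :
    ∑ w : ι → ℤˣ, ∏ k, f k (w k) = ∏ k, (f k 1 + f k (-1)) := by
  simp_rw [← sum_units, Finset.prod_univ_sum, Fintype.piFinset_univ]

/-- Expanding the product over the coordinates outside `R` recovers the Fourier sum. This form
exposes product weights on the cube, from which both the size bound and the rounding identity
follow. -/
theorem partialExt_eq_sum (F : (ι → ℤˣ) → ℝ) (R : Finset ι) (z : ι → ℝ) :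
    partialExt F R z = (∑ w : ι → ℤˣ, F w *
      ∏ k, if k ∈ R then ((w k : ℤ) : ℝ) else 1 + ((w k : ℤ) : ℝ) * z k) /
        2 ^ Fintype.card ι := by
  have hprod : ∀ w : ι → ℤˣ,
      (∏ k, if k ∈ R then ((w k : ℤ) : ℝ) else 1 + ((w k : ℤ) : ℝ) * z k) =
      ∑ S ∈ Finset.univ.filter (R ⊆ ·), (∏ i ∈ S, ((w i : ℤ) : ℝ)) * ∏ i ∈ S \ R, z i := by
    intro w
    rw [Finset.prod_ite, Finset.prod_one_add, Finset.mul_sum]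
    refine Finset.sum_nbij' (fun T => R ∪ T) (fun S => S \ R) ?_ ?_ ?_ ?_ ?_
    · intro T _; simp
    · intro S hS
      simp only [Finset.mem_powerset]
      intro x hx
      simpa using (Finset.mem_sdiff.1 hx).2
    · intro T hT
      simp only [Finset.mem_powerset] at hT
      ext x
      have := @hT x
      simp at this ⊢
      tauto
    · intro S hS
      simp at hS
      exact Finset.union_sdiff_of_subset hS
    · intro T hT
      simp only [Finset.mem_powerset] at hT
      have hd : Disjoint R T := by
        rw [Finset.disjoint_left]
        intro x hx hxT
        have := hT hxT
        simp at this
        exact this hx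
      rw [Finset.prod_union hd, Finset.union_sdiff_cancel_left hd, Finset.prod_mul_distrib]
      simp [mul_assoc]
  simp_rw [partialExt, cubeFourierCoeff, hprod, div_mul_eq_mul_div, ← Finset.sum_div,
    Finset.sum_mul, Finset.mul_sum]
  rw [Finset.sum_comm]
  simp_rw [mul_assoc]

/-- The absolute weights factor over coordinates, and `|1 + z| + |1 - z| = 2 max(1, |z|)`. -/
theorem abs_partialExt_le {F : (ι → ℤˣ) → ℝ} (hF : ∀ x, |F x| ≤ 1) (R : Finset ι) (z : ι → ℝ) :
    |partialExt F R z| ≤ ∏ k, max 1 |z k| := by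
  rw [partialExt_eq_sum, abs_div, abs_of_pos (by positivity : (0 : ℝ) < 2 ^ Fintype.card ι),
    div_le_iff₀ (by positivity)]
  calc _ ≤ ∑ w : ι → ℤˣ, ∏ k, |if k ∈ R then ((w k : ℤ) : ℝ) else 1 + ((w k : ℤ) : ℝ) * z k| := by
        refine (Finset.abs_sum_le_sum_abs _ _).trans (Finset.sum_le_sum fun w _ => ?_)
        rw [abs_mul, Finset.abs_prod]
        exact mul_le_of_le_one_left (by positivity) (hF w)
    _ = ∏ k, (|if k ∈ R then (1 : ℝ) else 1 + z k| + |if k ∈ R then (-1 : ℝ) else 1 - z k|) := by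
        rw [sum_prod_units fun k u => |if k ∈ R then ((u : ℤ) : ℝ) else 1 + ((u : ℤ) : ℝ) * z k|]
        simp [sub_eq_add_neg]
    _ ≤ ∏ k, (max 1 |z k| * 2) := by
        refine Finset.prod_le_prod (fun _ _ => by positivity) fun k _ => ?_
        have h1 := le_max_left 1 |z k|
        have h2 := (abs_le.1 (le_max_right 1 |z k|))
        split_ifs
        · simp; linarith
        · rcases abs_cases (1 + z k) with h | h <;> rcases abs_cases (1 - z k) with h' | h' <;>
            linarith
    _ = _ := by rw [Finset.prod_mul_distrib]; simp

theorem abs_trnc_le_one (a : ℝ) : |trnc a| ≤ 1 :=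
  abs_le.2 ⟨le_min (by norm_num) (le_max_left _ _), min_le_left _ _⟩

theorem trnc_eq_self {a : ℝ} (h : |a| ≤ 1) : trnc a = a := by
  rw [trnc, max_eq_right (abs_le.1 h).1, min_eq_right (abs_le.1 h).2]

theorem roundCoord_real_singleton (a : ℝ) (u : ℤˣ) :
    (roundCoord a).real {u} = (1 + ((u : ℤ) : ℝ) * trnc a) / 2 := by
  have h := abs_le.1 (abs_trnc_le_one a)
  rw [measureReal_def, roundCoord]
  rcases Int.units_eq_one_or u with rfl | rfl
  · simp [show (-1 : ℤˣ) ≠ 1 by decide]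
    linarith
  · simp [show (1 : ℤˣ) ≠ -1 by decide]
    rw [ENNReal.toReal_ofReal (by linarith)]
    ring

theorem integral_rounding (F : (ι → ℤˣ) → ℝ) (z : ι → ℝ) :
    ∫ w, F w ∂(rounding ι z) = multilinearExt F fun i => trnc (z i) := by
  rw [multilinearExt_eq_partialExt, partialExt_eq_sum]
  change ∫ w, F w ∂(Measure.pi fun i => roundCoord (z i)) = _
  rw [integral_fintype Integrable.of_finite, Finset.sum_div]
  refine Finset.sum_congr rfl fun w _ => ?_
  have : (Measure.pi fun i => roundCoord (z i)).real {w} =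
      ∏ i, (roundCoord (z i)).real {w i} := by
    simp [measureReal_def, Measure.pi_singleton, ENNReal.toReal_prod]
  rw [this]
  simp_rw [roundCoord_real_singleton, smul_eq_mul, Finset.prod_div_distrib]
  simp
  ring

/-- The probability that a coordinate is left free, or fixed to a given sign, in the random
restriction centred at `a`. -/
def restrictionWeight (a : ℝ) : Option ℤˣ → ℝ
  | none => 1 / 2
  | some b => (1 / 2 + ((b : ℤ) : ℝ) * a) / 2

theorem sum_option_units (f : Option ℤˣ → ℝ) : ∑ r, f r = f none + (f (some 1) + f (some (-1))) := by
  rw [Fintype.sum_option, sum_units]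

theorem sum_restrictionWeight (a : ℝ) : ∑ r, restrictionWeight a r = 1 := by
  rw [sum_option_units]; simp [restrictionWeight]; ring

theorem restrictionWeight_nonneg {a : ℝ} (h : |a| ≤ 1 / 2) (r : Option ℤˣ) :
    0 ≤ restrictionWeight a r := by
  have := abs_le.1 h
  rcases r with _ | b
  · simp [restrictionWeight]
  · rcases Int.units_eq_one_or b with rfl | rfl <;> simp [restrictionWeight] <;> linarith

theorem sum_prod_restrictionWeight (z : ι → ℝ) :
    ∑ ρ : ι → Option ℤˣ, ∏ k, restrictionWeight (z k) (ρ k) = 1 := by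
  have := Finset.prod_univ_sum (fun _ : ι => (Finset.univ : Finset (Option ℤˣ)))
    fun k r => restrictionWeight (z k) r
  rw [Fintype.piFinset_univ] at this
  rw [← this]
  simp_rw [sum_restrictionWeight, Finset.prod_const_one]

/-- Pushing forward a product weight along a coordinatewise map. -/
theorem sum_prod_pushforward {α β : Type*} [Fintype α] [Fintype β] [DecidableEq β]
    (G : (ι → β) → ℝ) (f : α → β) (a : ι → α → ℝ) :
    ∑ x : ι → α, (∏ k, a k (x k)) * G (fun k => f (x k)) =
      ∑ w : ι → β, G w * ∏ k, ∑ x : α, if f x = w k then a k x else 0 := by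
  classical
  simp_rw [Finset.prod_univ_sum, Fintype.piFinset_univ, Finset.mul_sum]
  rw [Finset.sum_comm]
  refine Finset.sum_congr rfl fun x _ => ?_
  rw [Finset.sum_eq_single fun k => f (x k)]
  · simp [mul_comm]
  · intro w _ hw
    obtain ⟨k, hk⟩ : ∃ k, f (x k) ≠ w k := by
      by_contra! h
      exact hw (funext fun k => (h k).symm)
    rw [Finset.prod_eq_zero (Finset.mem_univ k) (if_neg hk), mul_zero]
  · simp

/-- Draw a restriction and fill its free coordinates with uniform signs. A coordinate outside `R`
then has mean `z k`. In a coordinate of `R`, the fixed symbols cancel against the character of the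
fresh sign, and only the free symbol, of weight `1/2`, contributes. This is an algebraic identity;
the weights are nonnegative only for `|z k| ≤ 1/2`, which is why the good event uses that threshold.
-/
theorem sum_restrictionWeight_mul_coeff (F : (ι → ℤˣ) → ℝ) (R : Finset ι) (z : ι → ℝ) :
    ∑ ρ : ι → Option ℤˣ, (∏ k, restrictionWeight (z k) (ρ k)) * cubeFourierCoeff (restrict F ρ) R =
      partialExt F R z / 2 ^ R.card := by
  have key := sum_prod_pushforward F (fun x : Option ℤˣ × ℤˣ => x.1.getD x.2)
    fun k x => restrictionWeight (z k) x.1 * if k ∈ R then ((x.2 : ℤ) : ℝ) else 1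
  have hfac : ∀ (w : ι → ℤˣ) (k : ι),
      (∑ x : Option ℤˣ × ℤˣ, if x.1.getD x.2 = w k then
        restrictionWeight (z k) x.1 * (if k ∈ R then ((x.2 : ℤ) : ℝ) else 1) else 0) =
      (if k ∈ R then ((w k : ℤ) : ℝ) else 1 + ((w k : ℤ) : ℝ) * z k) *
        (if k ∈ R then 1 / 2 else 1) := by
    intro w k
    simp_rw [Fintype.sum_prod_type, sum_option_units, sum_units]
    have h1 : (1 : ℤˣ) ≠ -1 := by decide
    rcases Int.units_eq_one_or (w k) with h | h <;> by_cases hk : k ∈ R <;>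
      simp [h, hk, restrictionWeight, h1, h1.symm] <;> ring
  simp_rw [hfac, Finset.prod_mul_distrib] at key
  have hhalf : (∏ k : ι, if k ∈ R then (1 / 2 : ℝ) else 1) = 1 / 2 ^ R.card := by
    rw [Finset.prod_ite]
    simp
  rw [hhalf] at key
  replace key := ((Equiv.arrowProdEquivProdArrow ι (fun _ => Option ℤˣ) fun _ => ℤˣ).sum_comp
    (fun x => ((∏ k, restrictionWeight (z k) (x.1 k)) *
      ∏ k, if k ∈ R then ((x.2 k : ℤ) : ℝ) else 1) *
      F fun k => (x.1 k).getD (x.2 k))).symm.trans key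
  rw [Fintype.sum_prod_type] at key
  simp_rw [← mul_assoc, ← Finset.sum_mul] at key
  rw [partialExt_eq_sum, div_div, mul_comm (2 ^ _ : ℝ), ← div_div,
    ← mul_one_div _ (2 ^ R.card : ℝ), ← key]
  simp_rw [cubeFourierCoeff, restrict, Finset.sum_div, Finset.mul_sum]
  refine Finset.sum_congr rfl fun ρ _ => Finset.sum_congr rfl fun x _ => ?_
  rw [Finset.prod_ite_mem, Finset.univ_inter]
  ring

theorem sum_abs_partialExt_le {F : (ι → ℤˣ) → ℝ} {ℓ : ℝ}
    (hF : ∀ ρ : ι → Option ℤˣ, levelTwoNorm (restrict F ρ) ≤ ℓ)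
    {z : ι → ℝ} (hz : ∀ k, |z k| ≤ 1 / 2) :
    ∑ S ∈ Finset.univ.filter (fun S : Finset ι => S.card = 2), |partialExt F S z| ≤ 4 * ℓ := by
  have hw : ∀ ρ : ι → Option ℤˣ, 0 ≤ ∏ k, restrictionWeight (z k) (ρ k) := fun ρ =>
    Finset.prod_nonneg fun k _ => restrictionWeight_nonneg (hz k) _
  calc _ ≤ ∑ S ∈ Finset.univ.filter (fun S : Finset ι => S.card = 2),
        ∑ ρ : ι → Option ℤˣ, (∏ k, restrictionWeight (z k) (ρ k)) *
          (4 * |cubeFourierCoeff (restrict F ρ) S|) := by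
        refine Finset.sum_le_sum fun S hS => ?_
        have h2 : S.card = 2 := by simpa using hS
        have h := sum_restrictionWeight_mul_coeff F S z
        rw [h2, eq_div_iff (by norm_num)] at h
        rw [← h, Finset.sum_mul]
        refine (Finset.abs_sum_le_sum_abs _ _).trans (Finset.sum_le_sum fun ρ _ => ?_)
        rw [abs_mul, abs_mul, abs_of_nonneg (hw ρ)]
        norm_num
        linarith
    _ = ∑ ρ : ι → Option ℤˣ, (∏ k, restrictionWeight (z k) (ρ k)) *
          (4 * levelTwoNorm (restrict F ρ)) := by
        rw [Finset.sum_comm]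
        simp_rw [levelTwoNorm, Finset.mul_sum]
    _ ≤ ∑ ρ : ι → Option ℤˣ, (∏ k, restrictionWeight (z k) (ρ k)) * (4 * ℓ) :=
        Finset.sum_le_sum fun ρ _ => mul_le_mul_of_nonneg_left (by linarith [hF ρ]) (hw ρ)
    _ = 4 * ℓ := by rw [← Finset.sum_mul, sum_prod_restrictionWeight, one_mul]

end CubeLemmas

/-! ### Gaussian integration by parts and rotation invariance. -/

section GaussianLemmas

theorem integral_stdGaussianReal (f : ℝ → ℝ) :
    ∫ x, f x ∂(gaussianReal 0 1) =
      ∫ x, (Real.sqrt (2 * Real.pi))⁻¹ * (Real.exp (-(1 / 2) * x ^ 2) * f x) := by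
  rw [integral_gaussianReal_eq_integral_smul one_ne_zero]
  congr 1; ext x
  simp [gaussianPDFReal, div_eq_inv_mul, mul_assoc]

theorem integrable_stdGaussianReal {f : ℝ → ℝ}
    (hf : Integrable fun x : ℝ => Real.exp (-(1 / 2) * x ^ 2) * f x) :
    Integrable f (gaussianReal 0 1) := by
  rw [gaussianReal_of_var_ne_zero _ one_ne_zero,
    integrable_withDensity_iff_integrable_smul₀' (by fun_prop)
      (Filter.Eventually.of_forall fun _ => gaussianPDF_lt_top)]
  refine (hf.const_mul (Real.sqrt (2 * Real.pi))⁻¹).congr (Filter.Eventually.of_forall fun x => ?_)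
  simp [toReal_gaussianPDF, gaussianPDFReal, div_eq_inv_mul, mul_assoc]

theorem integrable_exp_neg_sq_mul_pow (a : ℕ) :
    Integrable fun x : ℝ => Real.exp (-(1 / 2) * x ^ 2) * x ^ a := by
  have h := integrable_rpow_mul_exp_neg_mul_sq (b := 1 / 2) (by norm_num) (s := a)
    (by have : (0 : ℝ) ≤ a := Nat.cast_nonneg a; linarith)
  simpa [mul_comm] using h

theorem integrable_pow_stdGaussianReal (a : ℕ) :
    Integrable (fun x : ℝ => x ^ a) (gaussianReal 0 1) :=
  integrable_stdGaussianReal (integrable_exp_neg_sq_mul_pow a)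

/-- Integration by parts against `x e^{-x²/2}`. For `a = 0` the exponent `a - 1` truncates to `0`,
but the factor `a` vanishes. -/
theorem integral_pow_succ_stdGaussianReal (a : ℕ) :
    ∫ x, x ^ (a + 1) ∂(gaussianReal 0 1) = a * ∫ x, x ^ (a - 1) ∂(gaussianReal 0 1) := by
  rw [integral_stdGaussianReal, integral_stdGaussianReal, integral_const_mul, integral_const_mul]
  have h1 := integrable_exp_neg_sq_mul_pow (a + 1)
  have h2 := integrable_exp_neg_sq_mul_pow (a - 1)
  have h3 := integrable_exp_neg_sq_mul_pow a
  have key := integral_mul_deriv_eq_deriv_mul_of_integrable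
    (u := fun x : ℝ => x ^ a) (v := fun x : ℝ => -Real.exp (-(1 / 2) * x ^ 2))
    (u' := fun x => a * x ^ (a - 1)) (v' := fun x => x * Real.exp (-(1 / 2) * x ^ 2))
    (fun x _ => hasDerivAt_pow a x)
    (fun x _ => by
      have := ((((hasDerivAt_id x).pow 2).const_mul (-(1 / 2) : ℝ)).exp).neg
      convert! this using 1
      simp; ring)
    (h1.congr (Filter.Eventually.of_forall fun x => by simp [pow_succ]; ring))
    ((h2.const_mul (-(a : ℝ))).congr (Filter.Eventually.of_forall fun x => by simp; ring))
    (h3.neg.congr (Filter.Eventually.of_forall fun x => by simp; ring))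
  have e1 : ∀ x : ℝ, Real.exp (-(1 / 2) * x ^ 2) * x ^ (a + 1) =
      x ^ a * (x * Real.exp (-(1 / 2) * x ^ 2)) := fun x => by ring
  have e2 : ∀ x : ℝ, a * x ^ (a - 1) * -Real.exp (-(1 / 2) * x ^ 2) =
      -(a * (Real.exp (-(1 / 2) * x ^ 2) * x ^ (a - 1))) := fun x => by ring
  simp_rw [e1]
  rw [key]
  simp_rw [e2]
  rw [integral_neg, integral_const_mul]
  ring

variable {σ : Type*} [Fintype σ]

/-- The standard Gaussian law on `ℝ^σ`. -/
abbrev stdGaussianPi (σ : Type*) [Fintype σ] : Measure (σ → ℝ) :=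
  Measure.pi fun _ => gaussianReal 0 1

theorem integrable_eval_stdGaussianPi (p : MvPolynomial σ ℝ) :
    Integrable (fun g => MvPolynomial.eval g p) (stdGaussianPi σ) := by
  induction p using MvPolynomial.induction_on' with
  | monomial u c =>
    simp_rw [MvPolynomial.eval_monomial, Finsupp.prod_fintype _ _ fun _ => pow_zero _]
    exact (Integrable.fintype_prod (f := fun i x => x ^ u i)
      fun i => integrable_pow_stdGaussianReal _).const_mul c
  | add p q hp hq => simp_rw [map_add]; exact hp.add hq

theorem integrable_of_eq_eval {f : (σ → ℝ) → ℝ} (p : MvPolynomial σ ℝ)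
    (hf : ∀ g, f g = MvPolynomial.eval g p) : Integrable f (stdGaussianPi σ) := by
  rw [funext hf]; exact integrable_eval_stdGaussianPi p

/-- Gaussian integration by parts for polynomials. -/
theorem integral_X_mul_eval [DecidableEq σ] (i : σ) (p : MvPolynomial σ ℝ) :
    ∫ g, g i * MvPolynomial.eval g p ∂(stdGaussianPi σ) =
      ∫ g, MvPolynomial.eval g (MvPolynomial.pderiv i p) ∂(stdGaussianPi σ) := by
  induction p using MvPolynomial.induction_on' with
  | monomial u c =>
    simp_rw [MvPolynomial.pderiv_monomial, MvPolynomial.eval_monomial,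
      Finsupp.prod_fintype _ _ fun _ => pow_zero _]
    have e1 : ∀ g : σ → ℝ, g i * (c * ∏ k, g k ^ u k) =
        c * ∏ k, g k ^ (u k + if k = i then 1 else 0) := by
      intro g
      simp_rw [pow_add, Finset.prod_mul_distrib]
      simp
      ring
    simp only [e1, integral_const_mul]
    rw [integral_fintype_prod_eq_prod (f := fun k (x : ℝ) => x ^ (u k + if k = i then 1 else 0)),
      integral_fintype_prod_eq_prod (f := fun k (x : ℝ) => x ^ ((u - Finsupp.single i 1 : σ →₀ ℕ) k)),
      ← Finset.mul_prod_erase _ _ (Finset.mem_univ i),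
      ← Finset.mul_prod_erase _ _ (Finset.mem_univ i)]
    simp only [if_true, integral_pow_succ_stdGaussianReal, Finsupp.coe_tsub, Pi.sub_apply,
      Finsupp.single_eq_same]
    have hk : ∀ k ∈ Finset.univ.erase i,
        ∫ x : ℝ, x ^ (u k + if k = i then 1 else 0) ∂(gaussianReal 0 1) =
          ∫ x : ℝ, x ^ (u k - (Finsupp.single i 1 : σ →₀ ℕ) k) ∂(gaussianReal 0 1) := by
      intro k hk
      simp [Finset.ne_of_mem_erase hk]
    rw [Finset.prod_congr rfl hk]
    ring
  | add p q hp hq =>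
    have hX : ∀ r : MvPolynomial σ ℝ,
        Integrable (fun g => g i * MvPolynomial.eval g r) (stdGaussianPi σ) := fun r => by
      exact integrable_of_eq_eval (MvPolynomial.X i * r) fun g => by simp
    simp_rw [map_add, mul_add]
    rw [integral_add (hX p) (hX q), hp, hq, integral_add] <;>
      exact integrable_eval_stdGaussianPi _

/-- The derivative in the direction `v`. -/
def dirDeriv (v : σ → ℝ) : Derivation ℝ (MvPolynomial σ ℝ) (MvPolynomial σ ℝ) :=
  MvPolynomial.mkDerivation ℝ fun i => MvPolynomial.C (v i)

omit [Fintype σ] in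
theorem dirDeriv_X (v : σ → ℝ) (i : σ) :
    dirDeriv v (MvPolynomial.X i) = MvPolynomial.C (v i) :=
  MvPolynomial.mkDerivation_X _ _ _

theorem integral_dotProduct_mul_eval [DecidableEq σ] (v : σ → ℝ) (p : MvPolynomial σ ℝ) :
    ∫ g, (v ⬝ᵥ g) * MvPolynomial.eval g p ∂(stdGaussianPi σ) =
      ∫ g, MvPolynomial.eval g (dirDeriv v p) ∂(stdGaussianPi σ) := by
  have hsum : ∀ (D : σ → Derivation ℝ (MvPolynomial σ ℝ) (MvPolynomial σ ℝ))
      (q : MvPolynomial σ ℝ), (∑ i, D i) q = ∑ i, D i q := fun D q => by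
    have h := congrFun (map_sum Derivation.coeFnAddMonoidHom D Finset.univ) q
    rwa [Finset.sum_apply] at h
  have hD : dirDeriv v p = ∑ i, MvPolynomial.C (v i) * MvPolynomial.pderiv i p := by
    have : dirDeriv v = ∑ i, (MvPolynomial.C (v i) : MvPolynomial σ ℝ) • MvPolynomial.pderiv i := by
      refine MvPolynomial.derivation_ext fun i => ?_
      rw [dirDeriv_X, hsum]
      simp [MvPolynomial.pderiv_X, Pi.single_apply]
    rw [this, hsum]
    rfl
  rw [hD]
  simp_rw [dotProduct, Finset.sum_mul, map_sum, map_mul, MvPolynomial.eval_C, mul_assoc]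
  rw [integral_finsetSum, integral_finsetSum]
  · simp_rw [integral_const_mul, integral_X_mul_eval]
  · exact fun i _ => (integrable_eval_stdGaussianPi _).const_mul _
  · intro i _
    refine Integrable.const_mul ?_ _
    exact integrable_of_eq_eval (MvPolynomial.X i * p) fun g => by simp

omit [Fintype σ] in
theorem derivation_prod {κ : Type*} [DecidableEq κ]
    (D : Derivation ℝ (MvPolynomial σ ℝ) (MvPolynomial σ ℝ))
    (s : Finset κ) (f : κ → MvPolynomial σ ℝ) :
    D (∏ i ∈ s, f i) = ∑ i ∈ s, (∏ j ∈ s.erase i, f j) * D (f i) := by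
  induction s using Finset.induction_on with
  | empty => simp
  | insert a s ha ih =>
    rw [Finset.prod_insert ha, D.leibniz, ih, Finset.sum_insert ha, Finset.erase_insert ha,
      smul_eq_mul, smul_eq_mul, Finset.mul_sum, add_comm]
    congr 1
    refine Finset.sum_congr rfl fun i hi => ?_
    rw [Finset.erase_insert_of_ne (fun h : a = i => ha (h ▸ hi)),
      Finset.prod_insert (fun h => ha (Finset.mem_of_mem_erase h)), mul_assoc]

theorem map_mulVec_stdGaussianPi [DecidableEq σ] {A : Matrix σ σ ℝ} (hA : Aᵀ * A = 1) :
    (stdGaussianPi σ).map (fun g => A *ᵥ g) = stdGaussianPi σ := by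
  let f : EuclideanSpace ℝ σ →ₗᵢ[ℝ] EuclideanSpace ℝ σ :=
    { toLinearMap := Matrix.toEuclideanLin A
      norm_map' := fun v => by
        rw [EuclideanSpace.norm_eq, EuclideanSpace.norm_eq]
        congr 1
        simp only [Real.norm_eq_abs, sq_abs]
        have h : (A *ᵥ v.ofLp) ⬝ᵥ (A *ᵥ v.ofLp) = v.ofLp ⬝ᵥ v.ofLp := by
          rw [Matrix.dotProduct_mulVec, Matrix.vecMul_mulVec, ← Matrix.dotProduct_mulVec,
            hA, Matrix.one_mulVec]
        simpa [dotProduct, ← sq] using h }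
  have h := stdGaussian_map (f.toLinearIsometryEquiv rfl)
  rw [← map_pi_eq_stdGaussian, Measure.map_map (by fun_prop) (by fun_prop)] at h
  have h2 := congrArg (Measure.map (WithLp.ofLp : EuclideanSpace ℝ σ → σ → ℝ)) h
  rw [Measure.map_map (by fun_prop) (by fun_prop), Measure.map_map (by fun_prop) (by fun_prop)] at h2
  have e1 : (WithLp.ofLp : EuclideanSpace ℝ σ → σ → ℝ) ∘ (WithLp.toLp 2) = id := rfl
  rw [e1, Measure.map_id] at h2
  exact h2

end GaussianLemmas

/-! ### The derivative of the interpolated expectation. -/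

section Interpolation

variable {σ : Type*} [Fintype σ]

/-- The linear form given by a row of the matrix. -/
def rowPoly (H : Matrix σ σ ℝ) (j : σ) : MvPolynomial σ ℝ :=
  ∑ k, MvPolynomial.C (H j k) * MvPolynomial.X k

theorem eval_rowPoly (H : Matrix σ σ ℝ) (j : σ) (g : σ → ℝ) :
    MvPolynomial.eval g (rowPoly H j) = (H *ᵥ g) j := by
  simp [rowPoly, Matrix.mulVec, dotProduct]

theorem dirDeriv_rowPoly (H : Matrix σ σ ℝ) (j : σ) (v : σ → ℝ) :
    dirDeriv v (rowPoly H j) = MvPolynomial.C (H j ⬝ᵥ v) := by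
  simp [rowPoly, dotProduct, dirDeriv_X, MvPolynomial.C_mul']

/-- The coordinates of `(g, (H g) ^ 2 - 1)`. -/
def coordPoly (H : Matrix σ σ ℝ) : σ ⊕ σ → MvPolynomial σ ℝ :=
  Sum.elim MvPolynomial.X fun j => rowPoly H j ^ 2 - 1

theorem dirDeriv_coordPoly_inr (H : Matrix σ σ ℝ) (j : σ) (v : σ → ℝ) :
    dirDeriv v (coordPoly H (Sum.inr j)) =
      MvPolynomial.C (2 * (H j ⬝ᵥ v)) * rowPoly H j := by
  rw [coordPoly, Sum.elim_inr, map_sub, Derivation.map_one_eq_zero, sub_zero,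
    Derivation.leibniz_pow, dirDeriv_rowPoly]
  simp [show (MvPolynomial.C 2 : MvPolynomial σ ℝ) = 2 from rfl]
  ring

/-- The expectation of a product of coordinates of `(g, (H g) ^ 2 - 1)`. -/
def coordMoment (H : Matrix σ σ ℝ) (S : Finset (σ ⊕ σ)) : ℝ :=
  ∫ g, MvPolynomial.eval g (∏ k ∈ S, coordPoly H k) ∂(stdGaussianPi σ)

variable [DecidableEq σ]

/-- The expectation of `H_{ji} (H g)_j` times the product of the coordinates in
`S \ {inl i, inr j}`, provided that `S` contains both. -/
def pairMoment (H : Matrix σ σ ℝ) (S : Finset (σ ⊕ σ)) (i j : σ) : ℝ :=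
  if {Sum.inl i, Sum.inr j} ⊆ S then H j i *
    ∫ g, MvPolynomial.eval g (rowPoly H j * ∏ k ∈ S \ {Sum.inl i, Sum.inr j}, coordPoly H k)
      ∂(stdGaussianPi σ)
  else 0

omit [DecidableEq σ] in
theorem integral_eval_C_mul (c : ℝ) (p : MvPolynomial σ ℝ) :
    ∫ g, MvPolynomial.eval g (MvPolynomial.C c * p) ∂(stdGaussianPi σ) =
      c * ∫ g, MvPolynomial.eval g p ∂(stdGaussianPi σ) := by
  simp_rw [map_mul, MvPolynomial.eval_C, integral_const_mul]

omit [DecidableEq σ] in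
theorem integral_eval_sum {κ : Type*} (s : Finset κ) (p : κ → MvPolynomial σ ℝ) :
    ∫ g, MvPolynomial.eval g (∑ k ∈ s, p k) ∂(stdGaussianPi σ) =
      ∑ k ∈ s, ∫ g, MvPolynomial.eval g (p k) ∂(stdGaussianPi σ) := by
  simp_rw [map_sum]
  exact integral_finsetSum _ fun k _ => integrable_eval_stdGaussianPi _

omit [Fintype σ] in
theorem erase_erase_eq_sdiff_pair (S : Finset (σ ⊕ σ)) (a b : σ ⊕ σ) :
    (S.erase a).erase b = S \ {a, b} := by
  ext x; simp; tauto

theorem sum_eq_sum_inl_add_sum_inr {s : Finset (σ ⊕ σ)} {f : σ ⊕ σ → ℝ} {g : σ → ℝ} {h : σ → ℝ}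
    (hl : ∀ i, (if Sum.inl i ∈ s then f (Sum.inl i) else 0) = g i)
    (hr : ∀ j, (if Sum.inr j ∈ s then f (Sum.inr j) else 0) = h j) :
    ∑ k ∈ s, f k = ∑ i, g i + ∑ j, h j := by
  rw [← Finset.sum_congr rfl fun i _ => hl i, ← Finset.sum_congr rfl fun i _ => hr i,
    ← Fintype.sum_sum_type (fun k => if k ∈ s then f k else 0)]
  simp

/-- Integrate by parts in the factor `g i`. The other linear factors do not depend on `g i`, and the
derivative of `(H g)_j² - 1` is `2 H_{ji} (H g)_j`. -/
theorem coordMoment_of_inl_mem (H : Matrix σ σ ℝ) {S : Finset (σ ⊕ σ)} {i : σ}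
    (hi : Sum.inl i ∈ S) : coordMoment H S = 2 * ∑ j, pairMoment H S i j := by
  rw [coordMoment]
  have h1 : ∀ g : σ → ℝ, MvPolynomial.eval g (∏ k ∈ S, coordPoly H k) =
      (Pi.single i 1 ⬝ᵥ g) * MvPolynomial.eval g (∏ k ∈ S.erase (Sum.inl i), coordPoly H k) := by
    intro g
    rw [← Finset.mul_prod_erase S _ hi]
    simp [coordPoly]
  simp_rw [h1]
  rw [integral_dotProduct_mul_eval, derivation_prod, integral_eval_sum,
    sum_eq_sum_inl_add_sum_inr (g := fun _ => 0) (h := fun j => 2 * pairMoment H S i j)]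
  · simp [Finset.mul_sum]
  · intro k
    split_ifs with hk
    · have : k ≠ i := by rintro rfl; simp at hk
      simp [coordPoly, dirDeriv_X, this]
    · rfl
  · intro j
    rw [pairMoment]
    by_cases hj : Sum.inr j ∈ S
    · rw [if_pos (by simp [hj]), if_pos (by simp [Finset.insert_subset_iff, hi, hj]),
        dirDeriv_coordPoly_inr, mul_left_comm, integral_eval_C_mul, erase_erase_eq_sdiff_pair,
        mul_comm (rowPoly H j)]
      simp
      ring
    · rw [if_neg (by simp [hj]), if_neg (by simp [Finset.insert_subset_iff, hj]), mul_zero]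

/-- Integrate by parts in one factor of `(H g)_j²`. Differentiating the other factor gives `‖H_j‖² =
1`, which cancels the centring; the other quadratic factors are killed by orthogonality of rows.
Only the linear factors remain. -/
theorem coordMoment_of_inr_mem {H : Matrix σ σ ℝ} (hH : H * Hᵀ = 1) {S : Finset (σ ⊕ σ)} {j : σ}
    (hj : Sum.inr j ∈ S) : coordMoment H S = ∑ i, pairMoment H S i j := by
  have hrow : ∀ k l, H k ⬝ᵥ H l = if k = l then 1 else 0 := fun k l => by
    have := congrFun (congrFun hH k) l
    rwa [Matrix.mul_apply, Matrix.one_apply] at this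
  rw [coordMoment]
  set q := ∏ k ∈ S.erase (Sum.inr j), coordPoly H k with hq
  have h1 : ∀ g : σ → ℝ, MvPolynomial.eval g (∏ k ∈ S, coordPoly H k) =
      (H j ⬝ᵥ g) * MvPolynomial.eval g (rowPoly H j * q) - MvPolynomial.eval g q := by
    intro g
    rw [← Finset.mul_prod_erase S _ hj, ← hq]
    simp [coordPoly, eval_rowPoly, Matrix.mulVec]
    ring
  simp_rw [h1]
  rw [integral_sub, integral_dotProduct_mul_eval, Derivation.leibniz, dirDeriv_rowPoly, hrow,
    if_pos rfl]
  rotate_left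
  · exact integrable_of_eq_eval (rowPoly H j * (rowPoly H j * q)) fun g => by
      simp [eval_rowPoly, Matrix.mulVec]
  · exact integrable_eval_stdGaussianPi _
  simp_rw [smul_eq_mul, map_one, mul_one, map_add]
  rw [integral_add (integrable_eval_stdGaussianPi _) (integrable_eval_stdGaussianPi _),
    add_sub_cancel_right, hq, derivation_prod, Finset.mul_sum, integral_eval_sum,
    sum_eq_sum_inl_add_sum_inr (g := fun i => pairMoment H S i j) (h := fun _ => 0)]
  · simp
  · intro i
    rw [pairMoment]
    by_cases hi : Sum.inl i ∈ S
    · rw [if_pos (by simp [hi]), if_pos (by simp [Finset.insert_subset_iff, hi, hj]),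
        Finset.erase_right_comm, erase_erase_eq_sdiff_pair, ← integral_eval_C_mul]
      simp only [coordPoly, Sum.elim_inl, dirDeriv_X]
      congr 1; ext g; congr 1; ring
    · rw [if_neg (by simp [hi]), if_neg (by simp [Finset.insert_subset_iff, hi])]
  · intro k
    split_ifs with hk
    · have : k ≠ j := by rintro rfl; simp at hk
      rw [dirDeriv_coordPoly_inr, hrow, if_neg this]
      simp
    · rfl

/-- The degree of homogeneity of the coordinates of `(g, (H g) ^ 2 - 1)`. -/
def coordDegree : σ ⊕ σ → ℕ := Sum.elim (fun _ => 1) fun _ => 2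

/-- Linear factors have degree `1` and expand with coefficient `2`; quadratic ones have degree `2`
and expand with coefficient `1`. Each kind thus contributes twice the double sum. The left side is
what differentiating the power of `s` produces. -/
theorem sum_coordDegree_mul_coordMoment {H : Matrix σ σ ℝ} (hH : H * Hᵀ = 1)
    (S : Finset (σ ⊕ σ)) :
    ((∑ k ∈ S, coordDegree k : ℕ) : ℝ) * coordMoment H S = 4 * ∑ i, ∑ j, pairMoment H S i j := by
  push_cast
  rw [Finset.sum_mul, sum_eq_sum_inl_add_sum_inr (g := fun i => 2 * ∑ j, pairMoment H S i j)
    (h := fun j => 2 * ∑ i, pairMoment H S i j), ← Finset.mul_sum, ← Finset.mul_sum,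
    Finset.sum_comm (f := fun j i => pairMoment H S i j)]
  · ring
  · intro i
    split_ifs with hi
    · simp [coordDegree, coordMoment_of_inl_mem H hi]
    · simp [pairMoment, Finset.insert_subset_iff, hi]
  · intro j
    split_ifs with hj
    · simp [coordDegree, coordMoment_of_inr_mem hH hj]
    · simp [pairMoment, Finset.insert_subset_iff, hj]

omit [DecidableEq σ] in
/-- The point `(X, Y ^ 2 - s ^ 2)` for `X = s g` and `Y = H X`. -/
def interpPoint (H : Matrix σ σ ℝ) (s : ℝ) (g : σ → ℝ) : σ ⊕ σ → ℝ :=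
  Sum.elim (fun i => s * g i) fun j => s ^ 2 * ((H *ᵥ g) j ^ 2 - 1)

omit [DecidableEq σ] in
theorem prod_interpPoint (H : Matrix σ σ ℝ) (s : ℝ) (g : σ → ℝ) (S : Finset (σ ⊕ σ)) :
    ∏ k ∈ S, interpPoint H s g k =
      s ^ (∑ k ∈ S, coordDegree k) * MvPolynomial.eval g (∏ k ∈ S, coordPoly H k) := by
  rw [← Finset.prod_pow_eq_pow_sum, map_prod, ← Finset.prod_mul_distrib]
  refine Finset.prod_congr rfl fun k _ => ?_
  rcases k with i | j <;> simp [interpPoint, coordDegree, coordPoly, eval_rowPoly]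

theorem integral_multilinearExt_interpPoint (F : (σ ⊕ σ → ℤˣ) → ℝ) (H : Matrix σ σ ℝ) (s : ℝ) :
    ∫ g, multilinearExt F (interpPoint H s g) ∂(stdGaussianPi σ) =
      ∑ S, cubeFourierCoeff F S * (s ^ (∑ k ∈ S, coordDegree k) * coordMoment H S) := by
  simp_rw [multilinearExt, prod_interpPoint, coordMoment]
  rw [integral_finsetSum]
  · simp_rw [integral_const_mul]
  · exact fun S _ => ((integrable_eval_stdGaussianPi _).const_mul _).const_mul _

theorem integral_mul_partialExt_interpPoint (F : (σ ⊕ σ → ℤˣ) → ℝ) (H : Matrix σ σ ℝ) (s : ℝ)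
    (i j : σ) :
    s ^ 2 * (H j i * ∫ g, (H *ᵥ g) j *
      partialExt F {Sum.inl i, Sum.inr j} (interpPoint H s g) ∂(stdGaussianPi σ)) =
      ∑ S, cubeFourierCoeff F S * (s ^ (∑ k ∈ S, coordDegree k - 1) * pairMoment H S i j) := by
  simp_rw [partialExt, prod_interpPoint, Finset.mul_sum, ← eval_rowPoly]
  rw [integral_finsetSum]
  · rw [Finset.mul_sum, Finset.mul_sum, Finset.sum_filter]
    refine Finset.sum_congr rfl fun S _ => ?_
    rw [pairMoment]
    split_ifs with hS
    · have hd : ∑ k ∈ S, coordDegree k - 1 =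
          2 + ∑ k ∈ S \ {Sum.inl i, Sum.inr j}, coordDegree k := by
        rw [← Finset.sum_sdiff hS, Finset.sum_pair (by simp)]
        simp [coordDegree]
        omega
      have e : ∀ g : σ → ℝ, MvPolynomial.eval g (rowPoly H j) * (cubeFourierCoeff F S *
          (s ^ (∑ k ∈ S \ {Sum.inl i, Sum.inr j}, coordDegree k) *
            MvPolynomial.eval g (∏ k ∈ S \ {Sum.inl i, Sum.inr j}, coordPoly H k))) =
          cubeFourierCoeff F S * (s ^ (∑ k ∈ S \ {Sum.inl i, Sum.inr j}, coordDegree k)) *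
            MvPolynomial.eval g
              (rowPoly H j * ∏ k ∈ S \ {Sum.inl i, Sum.inr j}, coordPoly H k) := by
        intro g
        rw [map_mul]
        ring
      simp_rw [e]
      rw [integral_const_mul, hd, pow_add]
      ring
    · simp
  · intro S _
    exact integrable_of_eq_eval (rowPoly H j * (MvPolynomial.C (cubeFourierCoeff F S) *
      (MvPolynomial.C (s ^ (∑ k ∈ S \ {Sum.inl i, Sum.inr j}, coordDegree k)) *
        ∏ k ∈ S \ {Sum.inl i, Sum.inr j}, coordPoly H k))) fun g => by
      simp only [map_mul, MvPolynomial.eval_C]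

theorem hasDerivAt_integral_interpPoint (F : (σ ⊕ σ → ℤˣ) → ℝ) {H : Matrix σ σ ℝ}
    (hH : H * Hᵀ = 1) (s : ℝ) :
    HasDerivAt (fun s => ∫ g, multilinearExt F (interpPoint H s g) ∂(stdGaussianPi σ))
      (4 * s ^ 2 * ∑ i, ∑ j, H j i * ∫ g, (H *ᵥ g) j *
        partialExt F {Sum.inl i, Sum.inr j} (interpPoint H s g) ∂(stdGaussianPi σ)) s := by
  have h : HasDerivAt (fun s : ℝ => ∑ S, cubeFourierCoeff F S *
      (s ^ (∑ k ∈ S, coordDegree k) * coordMoment H S))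
      (∑ S, cubeFourierCoeff F S * (((∑ k ∈ S, coordDegree k : ℕ) : ℝ) *
        s ^ (∑ k ∈ S, coordDegree k - 1) * coordMoment H S)) s :=
    HasDerivAt.fun_sum fun S _ =>
      ((hasDerivAt_pow (∑ k ∈ S, coordDegree k) s).mul_const _).const_mul _
  convert! h using 1
  · exact funext fun s => integral_multilinearExt_interpPoint F H s
  rw [mul_assoc, Finset.mul_sum, Finset.sum_congr rfl fun i _ => Finset.mul_sum _ _ _,
    Finset.sum_congr rfl fun i _ => Finset.sum_congr rfl fun j _ =>
      integral_mul_partialExt_interpPoint F H s i j,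
    Finset.sum_congr rfl fun i _ => Finset.sum_comm, Finset.sum_comm, Finset.mul_sum]
  refine Finset.sum_congr rfl fun S _ => ?_
  have := sum_coordDegree_mul_coordMoment hH S
  simp_rw [← Finset.mul_sum]
  linear_combination (-cubeFourierCoeff F S * s ^ (∑ k ∈ S, coordDegree k - 1)) * this

end Interpolation

/-! ### Exponential moments and the large-coordinate event. -/

section Tails

theorem integrable_exp_sq_stdGaussianReal {a : ℝ} (ha : a < 1 / 2) :
    Integrable (fun x : ℝ => Real.exp (a * x ^ 2)) (gaussianReal 0 1) := by
  refine integrable_stdGaussianReal ?_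
  refine (integrable_exp_neg_mul_sq (b := 1 / 2 - a) (by linarith)).congr
    (Filter.Eventually.of_forall fun x => ?_)
  dsimp only
  rw [← Real.exp_add]; congr 1; ring

/-- The value is `(1 - 2a)^{-1/2}`, at most `√(8/3)`. The exponent `5/16 = 1/4 + 1/16` is the
largest one occurring in `tailWeight`. -/
theorem integral_exp_sq_stdGaussianReal_le {a : ℝ} (ha : a ≤ 5 / 16) :
    ∫ x, Real.exp (a * x ^ 2) ∂(gaussianReal 0 1) ≤ 2 := by
  calc ∫ x, Real.exp (a * x ^ 2) ∂(gaussianReal 0 1)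
      ≤ ∫ x, Real.exp (5 / 16 * x ^ 2) ∂(gaussianReal 0 1) := by
        refine integral_mono (integrable_exp_sq_stdGaussianReal (by linarith))
          (integrable_exp_sq_stdGaussianReal (by norm_num)) fun x => ?_
        dsimp only
        gcongr
    _ = (Real.sqrt (2 * Real.pi))⁻¹ * Real.sqrt (Real.pi / (3 / 16)) := by
        rw [integral_stdGaussianReal, integral_const_mul, ← integral_gaussian]
        congr 2; ext x
        rw [← Real.exp_add]; congr 1; ring
    _ ≤ 2 := by
        have hpi := Real.pi_pos
        rw [inv_mul_le_iff₀ (by positivity)]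
        refine Real.sqrt_le_iff.2 ⟨by positivity, ?_⟩
        rw [mul_pow, Real.sq_sqrt (by positivity)]
        linarith

variable {σ : Type*} [Fintype σ]

/-- The product of the numbers `max 1 |x_k|`. -/
def normProd (x : σ → ℝ) : ℝ := ∏ k, max 1 |x k|

omit [Fintype σ] in
theorem one_le_prod_max_one (x : σ → ℝ) (t : Finset σ) : 1 ≤ ∏ k ∈ t, max 1 |x k| := by
  simpa using Finset.prod_le_prod (s := t) (f := fun _ => (1 : ℝ)) (fun _ _ => zero_le_one)
    fun k _ => le_max_left 1 |x k|

theorem one_le_normProd (x : σ → ℝ) : 1 ≤ normProd x :=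
  one_le_prod_max_one x Finset.univ

theorem max_one_abs_le_normProd (x : σ → ℝ) (k : σ) : max 1 |x k| ≤ normProd x := by
  classical
  rw [normProd, ← Finset.mul_prod_erase _ _ (Finset.mem_univ k)]
  exact le_mul_of_one_le_right (by positivity) (one_le_prod_max_one x _)

/-- An integrable weight that dominates the contribution of the event that `g_k` is large. -/
def tailWeight (δ : ℝ) (k : σ) (g : σ → ℝ) : ℝ :=
  Real.exp (1 / 16 * g k ^ 2) * ∏ l, (1 + δ * Real.exp (1 / 4 * g l ^ 2))

theorem tailWeight_nonneg {δ : ℝ} (hδ : 0 ≤ δ) (k : σ) (g : σ → ℝ) : 0 ≤ tailWeight δ k g :=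
  mul_nonneg (Real.exp_pos _).le (Finset.prod_nonneg fun _ _ => by positivity)

theorem tailWeight_eq_prod [DecidableEq σ] (δ : ℝ) (k : σ) (g : σ → ℝ) :
    tailWeight δ k g = ∏ l, (if l = k then Real.exp (1 / 16 * g l ^ 2) +
      δ * Real.exp (5 / 16 * g l ^ 2) else 1 + δ * Real.exp (1 / 4 * g l ^ 2)) := by
  rw [tailWeight, ← Finset.mul_prod_erase _ _ (Finset.mem_univ k),
    ← Finset.mul_prod_erase Finset.univ _ (Finset.mem_univ k), ← mul_assoc]
  congr 1
  · rw [if_pos rfl, mul_add, mul_one, mul_left_comm, ← Real.exp_add]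
    congr 3; ring
  · exact Finset.prod_congr rfl fun l hl => (if_neg (Finset.ne_of_mem_erase hl)).symm

omit [Fintype σ] in
theorem integrable_tailWeight_factor [DecidableEq σ] (δ : ℝ) (k l : σ) :
    Integrable (fun x : ℝ => if l = k then Real.exp (1 / 16 * x ^ 2) +
      δ * Real.exp (5 / 16 * x ^ 2) else 1 + δ * Real.exp (1 / 4 * x ^ 2)) (gaussianReal 0 1) := by
  split_ifs
  · exact (integrable_exp_sq_stdGaussianReal (by norm_num)).add
      ((integrable_exp_sq_stdGaussianReal (by norm_num)).const_mul δ)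
  · exact (integrable_const 1).add
      ((integrable_exp_sq_stdGaussianReal (by norm_num)).const_mul δ)

theorem integrable_tailWeight (δ : ℝ) (k : σ) : Integrable (tailWeight δ k) (stdGaussianPi σ) := by
  classical
  rw [funext (tailWeight_eq_prod δ k)]
  exact Integrable.fintype_prod (f := fun l (x : ℝ) => if l = k then Real.exp (1 / 16 * x ^ 2) +
      δ * Real.exp (5 / 16 * x ^ 2) else 1 + δ * Real.exp (1 / 4 * x ^ 2))
    fun l => integrable_tailWeight_factor δ k l

theorem integral_tailWeight_le {δ : ℝ} (hδ : 0 ≤ δ) (k : σ) :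
    ∫ g, tailWeight δ k g ∂(stdGaussianPi σ) ≤ 4 * Real.exp (2 * δ * Fintype.card σ) := by
  classical
  simp_rw [tailWeight_eq_prod]
  rw [integral_fintype_prod_eq_prod (f := fun l (x : ℝ) => if l = k then Real.exp (1 / 16 * x ^ 2) +
      δ * Real.exp (5 / 16 * x ^ 2) else 1 + δ * Real.exp (1 / 4 * x ^ 2))]
  calc _ ≤ ∏ l : σ, (if l = k then 4 else 1) * Real.exp (2 * δ) := by
        refine Finset.prod_le_prod (fun l _ => integral_nonneg fun x => ?_) fun l _ => ?_
        · dsimp only [Pi.zero_apply]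
          split_ifs <;> positivity
        · have h16 := integral_exp_sq_stdGaussianReal_le (a := 1 / 16) (by norm_num)
          have h4 := integral_exp_sq_stdGaussianReal_le (a := 1 / 4) (by norm_num)
          have h5 := integral_exp_sq_stdGaussianReal_le (a := 5 / 16) le_rfl
          have he := Real.add_one_le_exp (2 * δ)
          split_ifs
          · rw [integral_add (integrable_exp_sq_stdGaussianReal (by norm_num))
              ((integrable_exp_sq_stdGaussianReal (by norm_num)).const_mul δ), integral_const_mul]
            nlinarith
          · rw [integral_add (integrable_const 1)
              ((integrable_exp_sq_stdGaussianReal (by norm_num)).const_mul δ), integral_const_mul]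
            simp only [integral_const, probReal_univ, smul_eq_mul, one_mul]
            nlinarith
    _ = _ := by
        rw [Finset.prod_mul_distrib]
        simp [← Real.exp_nat_mul]
        ring_nf

/-- For `y = (s x)² ≥ 1` one has `y³ ≤ e^{3y}` and `x² ≥ L y`; then `3(y - 1) ≤ L(y - 1)/4` is
exactly where `12 ≤ L` enters. -/
theorem max_one_abs_pow_six_le {L s x : ℝ} (hL : 12 ≤ L) (hs : L * s ^ 2 ≤ 1) :
    max 1 |s * x| ^ 6 ≤ 1 + Real.exp (3 - L / 4) * Real.exp (1 / 4 * x ^ 2) := by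
  rcases le_total |s * x| 1 with h | h
  · rw [max_eq_left h]
    have := Real.exp_pos (3 - L / 4)
    have := Real.exp_pos (1 / 4 * x ^ 2)
    nlinarith [mul_pos ‹0 < Real.exp (3 - L / 4)› this]
  · rw [max_eq_right h, ← Real.exp_add]
    set y := (s * x) ^ 2 with hy
    have h1 : 1 ≤ y := by rw [hy, ← sq_abs]; nlinarith
    have h2 : L * y ≤ x ^ 2 := by
      rw [hy]; nlinarith [mul_le_mul_of_nonneg_right hs (sq_nonneg x)]
    have h3 : |s * x| ^ 6 = y ^ 3 := by rw [hy, ← sq_abs]; ring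
    have h4 : y ^ 3 ≤ Real.exp y ^ 3 := by
      gcongr
      linarith [Real.add_one_le_exp y]
    rw [h3]
    refine h4.trans ?_
    rw [← Real.exp_nat_mul]
    have : Real.exp ((3 : ℕ) * y) ≤ Real.exp (3 - L / 4 + 1 / 4 * x ^ 2) := by
      apply Real.exp_le_exp.2
      push_cast
      nlinarith
    linarith

theorem normProd_pow_six_le {L s : ℝ} (hL : 12 ≤ L) (hs : L * s ^ 2 ≤ 1) (g : σ → ℝ) :
    normProd (s • g) ^ 6 ≤ ∏ l, (1 + Real.exp (3 - L / 4) * Real.exp (1 / 4 * g l ^ 2)) := by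
  rw [normProd, ← Finset.prod_pow]
  exact Finset.prod_le_prod (fun _ _ => by positivity) fun l _ =>
    max_one_abs_pow_six_le hL hs

theorem normProd_pow_six_le_tailWeight {L s : ℝ} (hL : 12 ≤ L) (hs : L * s ^ 2 ≤ 1) (k : σ)
    (g : σ → ℝ) : normProd (s • g) ^ 6 ≤ tailWeight (Real.exp (3 - L / 4)) k g := by
  refine (normProd_pow_six_le hL hs g).trans (le_mul_of_one_le_left ?_ ?_)
  · exact Finset.prod_nonneg fun _ _ => by positivity
  · exact Real.one_le_exp (by positivity)

theorem exp_mul_normProd_pow_six_le {L s : ℝ} (hL : 12 ≤ L) (hs : L * s ^ 2 ≤ 1) (k : σ)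
    (g : σ → ℝ) : Real.exp (1 / 32 * g k ^ 2) ^ 2 * normProd (s • g) ^ 6 ≤
      tailWeight (Real.exp (3 - L / 4)) k g := by
  rw [tailWeight, ← Real.exp_nat_mul]
  have : (2 : ℕ) * (1 / 32 * g k ^ 2) = 1 / 16 * g k ^ 2 := by push_cast; ring
  rw [this]
  exact mul_le_mul_of_nonneg_left (normProd_pow_six_le hL hs g) (Real.exp_pos _).le

theorem one_le_exp_mul_exp {L s x : ℝ} (hL : 0 ≤ L) (hs : L * s ^ 2 ≤ 1) (hx : 1 / 2 < |s * x|) :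
    1 ≤ Real.exp (-(L / 128)) * Real.exp (1 / 32 * x ^ 2) := by
  rw [← Real.exp_add]
  apply Real.one_le_exp
  have h1 : 1 / 4 ≤ (s * x) ^ 2 := by rw [← sq_abs]; nlinarith
  nlinarith [mul_le_mul_of_nonneg_right hs (sq_nonneg x), mul_le_mul_of_nonneg_left h1 hL]

/-- In the application `h = H g` depends on `g`, so the product cannot be integrated factor by
factor. The inequality `2ab ≤ a² + b²` separates the two, at the price of the sixth power, and each
is then Gaussian by itself. The cube allows two powers for the squared coordinates and one for the
factor `Y_j` of the drift. -/
theorem normProd_mul_normProd_le_of_large {L s : ℝ} (hL : 12 ≤ L) (hs : L * s ^ 2 ≤ 1)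
    (g h : σ → ℝ) (hbad : ∃ k, 1 / 2 < |s * g k| ∨ 1 / 2 < |s * h k|) :
    normProd (s • g) * normProd (s • h) ^ 3 ≤ Real.exp (-(L / 128)) *
      ∑ k, (tailWeight (Real.exp (3 - L / 4)) k g + tailWeight (Real.exp (3 - L / 4)) k h) := by
  obtain ⟨k, hk⟩ := hbad
  have hW : ∀ (l : σ) (f : σ → ℝ), 0 ≤ tailWeight (Real.exp (3 - L / 4)) l f :=
    tailWeight_nonneg (Real.exp_pos _).le
  refine le_trans ?_ (mul_le_mul_of_nonneg_left (Finset.single_le_sum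
    (fun l _ => add_nonneg (hW l g) (hW l h)) (Finset.mem_univ k)) (Real.exp_pos _).le)
  have hp := one_le_normProd (s • g)
  have hq := one_le_normProd (s • h)
  set p := normProd (s • g) with hp'
  set q := normProd (s • h) with hq'
  have hp6 : p ^ 2 ≤ p ^ 6 := pow_le_pow_right₀ hp (by norm_num)
  have hη := Real.exp_pos (-(L / 128))
  have hpq : 0 ≤ p * q ^ 3 := by positivity
  rcases hk with hk | hk
  · have h1 := one_le_exp_mul_exp (by linarith) hs hk
    set e := Real.exp (1 / 32 * g k ^ 2) with he
    have h2 : e ^ 2 * p ^ 6 ≤ _ := exp_mul_normProd_pow_six_le hL hs k g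
    have h3 : q ^ 6 ≤ _ := normProd_pow_six_le_tailWeight hL hs k h
    have h4 : e ^ 2 * p ^ 2 ≤ e ^ 2 * p ^ 6 := mul_le_mul_of_nonneg_left hp6 (sq_nonneg e)
    calc p * q ^ 3 ≤ Real.exp (-(L / 128)) * e * (p * q ^ 3) := le_mul_of_one_le_left hpq h1
      _ = Real.exp (-(L / 128)) * ((e * p) * q ^ 3) := by ring
      _ ≤ _ := by
        refine mul_le_mul_of_nonneg_left ?_ hη.le
        nlinarith [sq_nonneg (e * p - q ^ 3), sq_nonneg (e * p + q ^ 3), sq_nonneg (e * p),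
          sq_nonneg (q ^ 3)]
  · have h1 := one_le_exp_mul_exp (by linarith) hs hk
    set e := Real.exp (1 / 32 * h k ^ 2) with he
    have h2 : e ^ 2 * q ^ 6 ≤ _ := exp_mul_normProd_pow_six_le hL hs k h
    have h3 : p ^ 6 ≤ _ := normProd_pow_six_le_tailWeight hL hs k g
    calc p * q ^ 3 ≤ Real.exp (-(L / 128)) * e * (p * q ^ 3) := le_mul_of_one_le_left hpq h1
      _ = Real.exp (-(L / 128)) * (p * (e * q ^ 3)) := by ring
      _ ≤ _ := by
        refine mul_le_mul_of_nonneg_left ?_ hη.le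
        nlinarith [sq_nonneg (p - e * q ^ 3), sq_nonneg (p + e * q ^ 3), sq_nonneg p,
          sq_nonneg (e * q ^ 3)]

/-- A bound on an integral from a bound `A` on the event that all coordinates of `s g` and
`s H g` are at most `1 / 2`, and a polynomial bound outside of it. -/
theorem abs_integral_le_of_bounds [DecidableEq σ] {H : Matrix σ σ ℝ} (hH : Hᵀ * H = 1)
    {L s A B : ℝ} (hL : 12 ≤ L) (hs : L * s ^ 2 ≤ 1) (hA : 0 ≤ A) (hB : 0 ≤ B)
    {f : (σ → ℝ) → ℝ}
    (hgood : ∀ g, (∀ k, |s * g k| ≤ 1 / 2) → (∀ k, |s * (H *ᵥ g) k| ≤ 1 / 2) → |f g| ≤ A)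
    (hall : ∀ g, |f g| ≤ B * (normProd (s • g) * normProd (s • H *ᵥ g) ^ 3)) :
    |∫ g, f g ∂(stdGaussianPi σ)| ≤ A + B * (Real.exp (-(L / 128)) * (Fintype.card σ *
      (8 * Real.exp (2 * Real.exp (3 - L / 4) * Fintype.card σ)))) := by
  set δ := Real.exp (3 - L / 4) with hδ
  have hmp : MeasurePreserving (fun g => H *ᵥ g) (stdGaussianPi σ) (stdGaussianPi σ) :=
    ⟨by fun_prop, map_mulVec_stdGaussianPi hH⟩
  have hH_int : ∀ k, Integrable (fun g => tailWeight δ k (H *ᵥ g)) (stdGaussianPi σ) := fun k =>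
    hmp.integrable_comp_of_integrable (integrable_tailWeight δ k)
  have hint : ∀ k, Integrable (fun g => tailWeight δ k g + tailWeight δ k (H *ᵥ g))
      (stdGaussianPi σ) := fun k =>
    (integrable_tailWeight δ k).add (hH_int k)
  have hint2 : Integrable (fun g => B * (Real.exp (-(L / 128)) *
      ∑ k, (tailWeight δ k g + tailWeight δ k (H *ᵥ g)))) (stdGaussianPi σ) :=
    ((integrable_finsetSum _ fun k _ => hint k).const_mul _).const_mul _
  have hnonneg : ∀ g, 0 ≤ B * (Real.exp (-(L / 128)) *
      ∑ k, (tailWeight δ k g + tailWeight δ k (H *ᵥ g))) := fun g =>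
    mul_nonneg hB (mul_nonneg (Real.exp_pos _).le (Finset.sum_nonneg fun k _ =>
      add_nonneg (tailWeight_nonneg (Real.exp_pos _).le k _)
        (tailWeight_nonneg (Real.exp_pos _).le k _)))
  calc |∫ g, f g ∂(stdGaussianPi σ)|
      ≤ ∫ g, (A + B * (Real.exp (-(L / 128)) *
          ∑ k, (tailWeight δ k g + tailWeight δ k (H *ᵥ g)))) ∂(stdGaussianPi σ) := by
        rw [← Real.norm_eq_abs]
        refine norm_integral_le_of_norm_le ((integrable_const A).add hint2)
          (Filter.Eventually.of_forall fun g => ?_)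
        rw [Real.norm_eq_abs]
        by_cases hg : ∃ k, 1 / 2 < |s * g k| ∨ 1 / 2 < |s * (H *ᵥ g) k|
        · have := normProd_mul_normProd_le_of_large hL hs g (H *ᵥ g) hg
          have := (hall g).trans (mul_le_mul_of_nonneg_left this hB)
          linarith
        · push Not at hg
          have := hgood g (fun k => (hg k).1) fun k => (hg k).2
          linarith [hnonneg g]
    _ ≤ _ := by
        rw [integral_add (integrable_const A) hint2, integral_const_mul, integral_const_mul,
          integral_finsetSum _ fun k _ => hint k]
        simp only [integral_const, probReal_univ, smul_eq_mul, one_mul]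
        gcongr
        calc _ ≤ ∑ _k : σ, 8 * Real.exp (2 * δ * Fintype.card σ) := by
              refine Finset.sum_le_sum fun k _ => ?_
              have h1 := integral_tailWeight_le (Real.exp_pos (3 - L / 4)).le k
              -- Orthogonality of `H` makes `H g` standard Gaussian.
              have h2 : ∫ g, tailWeight δ k (H *ᵥ g) ∂(stdGaussianPi σ) =
                  ∫ g, tailWeight δ k g ∂(stdGaussianPi σ) := by
                conv_rhs => rw [← map_mulVec_stdGaussianPi hH]
                rw [integral_map (by fun_prop)]
                rw [map_mulVec_stdGaussianPi hH]
                exact (integrable_tailWeight δ k).aestronglyMeasurable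
              rw [integral_add (integrable_tailWeight δ k) (hH_int k), h2]
              linarith
          _ = _ := by simp

end Tails

/-! ### Bounds on the drift and on the truncation error. -/

section InterpolationBounds

variable {σ : Type*} [Fintype σ]

theorem prod_max_one_interpPoint_le (H : Matrix σ σ ℝ) {s : ℝ} (hs : s ^ 2 ≤ 1) (g : σ → ℝ) :
    ∏ k, max 1 |interpPoint H s g k| ≤ normProd (s • g) * normProd (s • H *ᵥ g) ^ 2 := by
  rw [Fintype.prod_sum_type, normProd, normProd, ← Finset.prod_pow]
  refine mul_le_mul le_rfl (Finset.prod_le_prod (fun _ _ => by positivity) fun j _ => ?_)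
    (Finset.prod_nonneg fun _ _ => by positivity) (Finset.prod_nonneg fun _ _ => by positivity)
  simp only [interpPoint, Sum.elim_inr, Pi.smul_apply, smul_eq_mul]
  set y := s * (H *ᵥ g) j with hy
  have h1 : s ^ 2 * ((H *ᵥ g) j ^ 2 - 1) = |y| ^ 2 - s ^ 2 := by rw [sq_abs, hy]; ring
  have h2 := le_max_left 1 |y|
  have h3 := le_max_right 1 |y|
  have h4 : |y| ^ 2 ≤ max 1 |y| ^ 2 := by gcongr
  rw [h1]
  refine max_le (by nlinarith) (abs_le.2 ⟨by nlinarith [sq_nonneg |y|], by nlinarith⟩)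

theorem abs_interpPoint_le {H : Matrix σ σ ℝ} {s : ℝ} (hs : s ^ 2 ≤ 1 / 2) {g : σ → ℝ}
    (hX : ∀ k, |s * g k| ≤ 1 / 2) (hY : ∀ k, |s * (H *ᵥ g) k| ≤ 1 / 2) (k : σ ⊕ σ) :
    |interpPoint H s g k| ≤ 1 / 2 := by
  rcases k with i | j
  · exact hX i
  · have h1 := hY j
    simp only [interpPoint, Sum.elim_inr]
    set y := s * (H *ᵥ g) j with hy
    have h2 : s ^ 2 * ((H *ᵥ g) j ^ 2 - 1) = |y| ^ 2 - s ^ 2 := by rw [sq_abs, hy]; ring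
    have h3 := abs_nonneg y
    rw [h2]
    exact abs_le.2 ⟨by nlinarith, by nlinarith [sq_nonneg s]⟩

variable [DecidableEq σ]

theorem sum_sum_abs_partialExt_le {F : (σ ⊕ σ → ℤˣ) → ℝ} {ℓ : ℝ}
    (hF : ∀ ρ : σ ⊕ σ → Option ℤˣ, levelTwoNorm (restrict F ρ) ≤ ℓ)
    {z : σ ⊕ σ → ℝ} (hz : ∀ k, |z k| ≤ 1 / 2) :
    ∑ i, ∑ j, |partialExt F {Sum.inl i, Sum.inr j} z| ≤ 4 * ℓ := by
  refine le_trans ?_ (sum_abs_partialExt_le hF hz)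
  rw [← Fintype.sum_prod_type' (fun i j => |partialExt F {Sum.inl i, Sum.inr j} z|),
    ← Finset.sum_image (s := Finset.univ)
      (g := fun p : σ × σ => ({Sum.inl p.1, Sum.inr p.2} : Finset (σ ⊕ σ)))
      (f := fun S => |partialExt F S z|)]
  · refine Finset.sum_le_sum_of_subset_of_nonneg ?_ fun _ _ _ => abs_nonneg _
    intro S hS
    obtain ⟨p, -, rfl⟩ := Finset.mem_image.1 hS
    simp
  · rintro ⟨i, j⟩ - ⟨i', j'⟩ - h
    dsimp only at h
    have h1 : (Sum.inl i : σ ⊕ σ) ∈ ({Sum.inl i', Sum.inr j'} : Finset (σ ⊕ σ)) := by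
      rw [← h]; simp
    have h2 : (Sum.inr j : σ ⊕ σ) ∈ ({Sum.inl i', Sum.inr j'} : Finset (σ ⊕ σ)) := by
      rw [← h]; simp
    simp at h1 h2
    rw [h1, h2]

/-- The part of the time derivative along the interpolation that is integrated over `g`. -/
def driftTerm (F : (σ ⊕ σ → ℤˣ) → ℝ) (H : Matrix σ σ ℝ) (s : ℝ) (g : σ → ℝ) : ℝ :=
  ∑ i, ∑ j, H j i * ((s * (H *ᵥ g) j) * partialExt F {Sum.inl i, Sum.inr j} (interpPoint H s g))

theorem abs_driftTerm_le {F : (σ ⊕ σ → ℤˣ) → ℝ} {H : Matrix σ σ ℝ} {b c : ℝ}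
    (hH : ∀ i j, |H i j| ≤ b) {s : ℝ} {g : σ → ℝ} (hc : ∀ j, |s * (H *ᵥ g) j| ≤ c) :
    |driftTerm F H s g| ≤
      b * (c * ∑ i, ∑ j, |partialExt F {Sum.inl i, Sum.inr j} (interpPoint H s g)|) := by
  simp_rw [driftTerm, Finset.mul_sum]
  refine (Finset.abs_sum_le_sum_abs _ _).trans (Finset.sum_le_sum fun i _ =>
    (Finset.abs_sum_le_sum_abs _ _).trans (Finset.sum_le_sum fun j _ => ?_))
  rw [abs_mul, abs_mul]
  have hb : 0 ≤ b := (abs_nonneg _).trans (hH j i)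
  gcongr
  · exact hH j i
  · exact hc j

theorem integrable_mul_partialExt_interpPoint (F : (σ ⊕ σ → ℤˣ) → ℝ) (H : Matrix σ σ ℝ) (s : ℝ)
    (j : σ) (R : Finset (σ ⊕ σ)) :
    Integrable (fun g => (H *ᵥ g) j * partialExt F R (interpPoint H s g)) (stdGaussianPi σ) := by
  have : ∀ k, ∃ p : MvPolynomial σ ℝ, ∀ g, interpPoint H s g k = MvPolynomial.eval g p := by
    rintro (i | j)
    · exact ⟨MvPolynomial.C s * MvPolynomial.X i, fun g => by simp [interpPoint]⟩
    · exact ⟨MvPolynomial.C (s ^ 2) * (rowPoly H j ^ 2 - 1), fun g => by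
        simp [interpPoint, eval_rowPoly]⟩
  choose p hp using this
  refine integrable_of_eq_eval (rowPoly H j * ∑ S ∈ Finset.univ.filter (R ⊆ ·),
    MvPolynomial.C (cubeFourierCoeff F S) * ∏ i ∈ S \ R, p i) fun g => ?_
  simp [partialExt, hp, eval_rowPoly]

/-- One power of `s` is absorbed into `s (H g)_j`, which is at most `1/2` on the good event; the
other supplies, after integration, the factor `s ^ 2 = ε`. -/
theorem hasDerivAt_integral_driftTerm (F : (σ ⊕ σ → ℤˣ) → ℝ) {H : Matrix σ σ ℝ}
    (hH : H * Hᵀ = 1) (s : ℝ) :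
    HasDerivAt (fun s => ∫ g, multilinearExt F (interpPoint H s g) ∂(stdGaussianPi σ))
      (4 * s * ∫ g, driftTerm F H s g ∂(stdGaussianPi σ)) s := by
  convert! hasDerivAt_integral_interpPoint F hH s using 1
  have hint : ∀ i j, Integrable (fun g => H j i * ((s * (H *ᵥ g) j) *
      partialExt F {Sum.inl i, Sum.inr j} (interpPoint H s g))) (stdGaussianPi σ) := fun i j => by
    simp_rw [mul_assoc s]
    exact ((integrable_mul_partialExt_interpPoint F H s j _).const_mul s).const_mul _
  simp_rw [driftTerm]
  rw [integral_finsetSum _ fun i _ => integrable_finsetSum _ fun j _ => hint i j,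
    Finset.mul_sum, Finset.mul_sum]
  refine Finset.sum_congr rfl fun i _ => ?_
  rw [integral_finsetSum _ fun j _ => hint i j, Finset.mul_sum, Finset.mul_sum]
  refine Finset.sum_congr rfl fun j _ => ?_
  simp_rw [mul_assoc s, integral_const_mul]
  ring

/-- The mass of the tail event in the interpolation bounds. -/
def tailBound (L N : ℝ) : ℝ :=
  Real.exp (-(L / 128)) * (N * (8 * Real.exp (2 * Real.exp (3 - L / 4) * N)))

theorem abs_integral_driftTerm_le {F : (σ ⊕ σ → ℤˣ) → ℝ} {H : Matrix σ σ ℝ} {b ℓ L s : ℝ}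
    (hH : Hᵀ * H = 1) (hHb : ∀ i j, |H i j| ≤ b) (hb : 0 ≤ b) (hF1 : ∀ x, |F x| ≤ 1)
    (hℓ : 0 ≤ ℓ) (hF : ∀ ρ : σ ⊕ σ → Option ℤˣ, levelTwoNorm (restrict F ρ) ≤ ℓ)
    (hL : 12 ≤ L) (hs : L * s ^ 2 ≤ 1) :
    |∫ g, driftTerm F H s g ∂(stdGaussianPi σ)| ≤
      b * (2 * ℓ) + b * Fintype.card σ ^ 2 * tailBound L (Fintype.card σ) := by
  have hs2 : s ^ 2 ≤ 1 / 2 := by nlinarith [sq_nonneg s]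
  refine abs_integral_le_of_bounds hH hL hs (by positivity) (by positivity) ?_ ?_
  · intro g hX hY
    refine (abs_driftTerm_le hHb hY).trans ?_
    have := sum_sum_abs_partialExt_le hF (abs_interpPoint_le hs2 hX hY)
    exact mul_le_mul_of_nonneg_left (by linarith) hb
  · intro g
    refine (abs_driftTerm_le hHb (c := normProd (s • H *ᵥ g)) fun j =>
      (le_max_right 1 _).trans (max_one_abs_le_normProd (s • H *ᵥ g) j)).trans ?_
    have hq := one_le_normProd (s • H *ᵥ g)
    have h1 : ∑ i, ∑ j, |partialExt F {Sum.inl i, Sum.inr j} (interpPoint H s g)| ≤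
        Fintype.card σ ^ 2 * (normProd (s • g) * normProd (s • H *ᵥ g) ^ 2) := by
      calc _ ≤ ∑ _i : σ, ∑ _j : σ, normProd (s • g) * normProd (s • H *ᵥ g) ^ 2 :=
            Finset.sum_le_sum fun i _ => Finset.sum_le_sum fun j _ =>
              (abs_partialExt_le hF1 _ _).trans (prod_max_one_interpPoint_le H (by linarith) g)
        _ = _ := by simp; ring
    calc _ ≤ b * (normProd (s • H *ᵥ g) * (Fintype.card σ ^ 2 *
          (normProd (s • g) * normProd (s • H *ᵥ g) ^ 2))) := by gcongr
      _ = _ := by ring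

theorem abs_integral_trnc_sub_le {F : (σ ⊕ σ → ℤˣ) → ℝ} {H : Matrix σ σ ℝ} {L s : ℝ}
    (hH : Hᵀ * H = 1) (hF1 : ∀ x, |F x| ≤ 1) (hL : 12 ≤ L) (hs : L * s ^ 2 ≤ 1) :
    |∫ g, (multilinearExt F (fun k => trnc (interpPoint H s g k)) -
      multilinearExt F (interpPoint H s g)) ∂(stdGaussianPi σ)| ≤
        2 * tailBound L (Fintype.card σ) := by
  have hs2 : s ^ 2 ≤ 1 / 2 := by nlinarith [sq_nonneg s]
  rw [← zero_add (2 * _)]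
  refine abs_integral_le_of_bounds hH hL hs le_rfl (by positivity) ?_ ?_
  · intro g hX hY
    have : (fun k => trnc (interpPoint H s g k)) = interpPoint H s g := funext fun k =>
      trnc_eq_self ((abs_interpPoint_le hs2 hX hY k).trans (by norm_num))
    rw [this, sub_self, abs_zero]
  · intro g
    have hp := one_le_normProd (s • g)
    have hq := one_le_normProd (s • H *ᵥ g)
    have h1 : |multilinearExt F (interpPoint H s g)| ≤
        normProd (s • g) * normProd (s • H *ᵥ g) ^ 2 := by
      rw [multilinearExt_eq_partialExt]
      exact (abs_partialExt_le hF1 _ _).trans (prod_max_one_interpPoint_le H (by linarith) g)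
    have h2 : |multilinearExt F (fun k => trnc (interpPoint H s g k))| ≤ 1 := by
      rw [multilinearExt_eq_partialExt]
      refine (abs_partialExt_le hF1 _ _).trans (le_of_eq ?_)
      exact Finset.prod_eq_one fun k _ => max_eq_left (abs_trnc_le_one _)
    have h3 : normProd (s • H *ᵥ g) ^ 2 ≤ normProd (s • H *ᵥ g) ^ 3 :=
      pow_le_pow_right₀ hq (by norm_num)
    have h4 : normProd (s • g) * normProd (s • H *ᵥ g) ^ 2 ≤
        normProd (s • g) * normProd (s • H *ᵥ g) ^ 3 := by gcongr
    have h5 : 1 ≤ normProd (s • g) * normProd (s • H *ᵥ g) ^ 3 :=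
      one_le_mul_of_one_le_of_one_le hp (one_le_pow₀ hq)
    refine (abs_sub _ _).trans ?_
    linarith

theorem abs_integral_interpPoint_sub_le {F : (σ ⊕ σ → ℤˣ) → ℝ} {H : Matrix σ σ ℝ} {b ℓ L s : ℝ}
    (hH : Hᵀ * H = 1) (hHb : ∀ i j, |H i j| ≤ b) (hb : 0 ≤ b) (hF1 : ∀ x, |F x| ≤ 1)
    (hℓ : 0 ≤ ℓ) (hF : ∀ ρ : σ ⊕ σ → Option ℤˣ, levelTwoNorm (restrict F ρ) ≤ ℓ)
    (hL : 12 ≤ L) (hs0 : 0 ≤ s) (hs : L * s ^ 2 ≤ 1) :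
    |∫ g, multilinearExt F (interpPoint H s g) ∂(stdGaussianPi σ) - multilinearExt F 0| ≤
      4 * s ^ 2 * (b * (2 * ℓ) + b * Fintype.card σ ^ 2 * tailBound L (Fintype.card σ)) := by
  set A := b * (2 * ℓ) + b * Fintype.card σ ^ 2 * tailBound L (Fintype.card σ) with hA
  have h0 : ∫ g, multilinearExt F (interpPoint H 0 g) ∂(stdGaussianPi σ) = multilinearExt F 0 := by
    have : ∀ g : σ → ℝ, interpPoint H 0 g = 0 := fun g => by
      ext k; rcases k with i | j <;> simp [interpPoint]
    simp [this]
  have hH' : H * Hᵀ = 1 := mul_eq_one_comm.1 hH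
  -- The derivative bound `4 t A` is replaced by its value at `t = s`, losing only a factor `2`.
  have key := norm_image_sub_le_of_norm_deriv_le_segment' (a := 0) (b := s) (C := 4 * s * A)
    (f := fun s => ∫ g, multilinearExt F (interpPoint H s g) ∂(stdGaussianPi σ))
    (fun t _ => (hasDerivAt_integral_driftTerm F hH' t).hasDerivWithinAt) (fun t ht => by
      have ht2 : t ^ 2 ≤ s ^ 2 := by gcongr; exacts [ht.1, ht.2.le]
      have := abs_integral_driftTerm_le hH hHb hb hF1 hℓ hF hL (s := t) (by nlinarith)
      rw [Real.norm_eq_abs, abs_mul, abs_mul, abs_of_nonneg ht.1, abs_of_pos (by norm_num : (0:ℝ) < 4)]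
      have ht1 := ht.1
      have hts := ht.2.le
      gcongr) s ⟨hs0, le_rfl⟩
  rw [h0, Real.norm_eq_abs] at key
  refine key.trans (le_of_eq ?_)
  ring

end InterpolationBounds

/-! ### Orthogonality of the Hadamard matrix. -/

section Hadamard

theorem hadamard_apply (n : ℕ) (x y : Idx n) :
    hadamard n x y = (∏ k, if x k = true ∧ y k = true then (-1 : ℝ) else 1) / √(2 ^ n) := by
  rw [hadamard, Matrix.of_apply, Finset.prod_ite]
  simp

theorem abs_hadamard (n : ℕ) (x y : Idx n) : |hadamard n x y| = 1 / √(2 ^ n) := by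
  rw [hadamard, Matrix.of_apply, abs_div, abs_pow, abs_neg, abs_one, one_pow,
    abs_of_nonneg (Real.sqrt_nonneg _)]

/-- The inner product of two columns factors over the bits, and a bit where `x` and `y` differ
contributes `1 - 1 = 0`. -/
theorem hadamard_transpose_mul_self (n : ℕ) : (hadamard n)ᵀ * hadamard n = 1 := by
  ext x y
  rw [Matrix.mul_apply, Matrix.one_apply]
  simp_rw [Matrix.transpose_apply, hadamard_apply, div_mul_div_comm, ← Finset.prod_mul_distrib]
  rw [Real.mul_self_sqrt (by positivity), ← Finset.sum_div]
  have h := Finset.prod_univ_sum (fun _ : Fin n => (Finset.univ : Finset Bool)) fun k b =>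
    (if b = true ∧ x k = true then (-1 : ℝ) else 1) * if b = true ∧ y k = true then -1 else 1
  rw [Fintype.piFinset_univ] at h
  rw [← h]
  split_ifs with hxy
  · subst hxy
    have : ∀ k, ∑ b : Bool, (if b = true ∧ x k = true then (-1 : ℝ) else 1) *
        (if b = true ∧ x k = true then -1 else 1) = 2 := fun k => by
      cases x k <;> norm_num
    simp_rw [this]
    simp
  · obtain ⟨k, hk⟩ := Function.ne_iff.1 hxy
    rw [Finset.prod_eq_zero (Finset.mem_univ k), zero_div]
    revert hk
    cases x k <;> cases y k <;> simp

end Hadamard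

/-! ### Numerical size of the tail. -/

section Constants

/-- Since `4096 = 16 · 256`, `e^{-L/256} ≤ N^{-16}`, which beats all powers of `N` present. In the
second bound the other half of `e^{-L/128}` absorbs the factor `L = 1/ε`. -/
theorem tailBound_le {C N : ℝ} (hC : 4096 ≤ C) (hN : 2 ≤ N) :
    N ^ 2 * tailBound (C * Real.log N) N ≤ 1 ∧
      2 * tailBound (C * Real.log N) N ≤ 1 / (C * Real.log N) / √N := by
  set L := C * Real.log N with hL
  have hlog2 := Real.log_two_gt_d9
  have hlog : Real.log 2 ≤ Real.log N := Real.log_le_log (by norm_num) hN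
  have hLN : 4096 * Real.log N ≤ L := mul_le_mul_of_nonneg_right hC (by linarith)
  have hN0 : 0 < N := by linarith
  have hexp : ∀ m : ℕ, Real.exp (-(m * Real.log N)) = (N ^ m)⁻¹ := fun m => by
    rw [Real.exp_neg, Real.exp_nat_mul, Real.exp_log hN0]
  have h1 : 2 * Real.exp (3 - L / 4) * N ≤ 1 := by
    calc 2 * Real.exp (3 - L / 4) * N
        = Real.exp (Real.log 2 + (3 - L / 4) + Real.log N) := by
          rw [Real.exp_add, Real.exp_add, Real.exp_log hN0, Real.exp_log (by norm_num)]
      _ ≤ 1 := Real.exp_le_one_iff.2 (by linarith)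
  have h2 : Real.exp (2 * Real.exp (3 - L / 4) * N) ≤ 3 :=
    (Real.exp_le_exp.2 h1).trans (Real.exp_one_lt_d9.le.trans (by norm_num))
  have h3 : tailBound L N ≤ 24 * N * Real.exp (-(L / 128)) := by
    rw [tailBound]
    have := mul_le_mul_of_nonneg_left h2 (mul_pos hN0 (Real.exp_pos (-(L / 128)))).le
    nlinarith
  have h4 : Real.exp (-(L / 256)) ≤ (N ^ 16)⁻¹ := by
    rw [← hexp]
    apply Real.exp_le_exp.2
    push_cast
    linarith
  have h5 : Real.exp (-(L / 128)) = Real.exp (-(L / 256)) * Real.exp (-(L / 256)) := by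
    rw [← Real.exp_add]; congr 1; ring
  have h6 : Real.exp (-(L / 256)) ≤ 1 := Real.exp_le_one_iff.2 (by linarith)
  have hpow : ∀ m : ℕ, (2 : ℝ) ^ m ≤ N ^ m := fun m => by gcongr
  constructor
  · calc N ^ 2 * tailBound L N ≤ N ^ 2 * (24 * N * (N ^ 16)⁻¹) := by
          gcongr
          refine h3.trans ?_
          gcongr
          rw [h5]
          exact (mul_le_of_le_one_left (Real.exp_pos _).le h6).trans h4
      _ = 24 * N ^ 3 / N ^ 16 := by ring
      _ ≤ 1 := by
          rw [div_le_one (by positivity)]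
          have := hpow 13
          have h3 : 0 < N ^ 3 := by positivity
          nlinarith
  · have hLpos : 0 < L := by linarith
    have h7 : L * Real.exp (-(L / 256)) ≤ 256 := by
      rw [Real.exp_neg, ← div_eq_mul_inv, div_le_iff₀ (Real.exp_pos _)]
      linarith [Real.add_one_le_exp (L / 256)]
    have h8 : √N ≤ N := Real.sqrt_le_iff.2 ⟨hN0.le, by nlinarith⟩
    rw [div_div, le_div_iff₀ (by positivity)]
    calc 2 * tailBound L N * (L * √N)
        ≤ 2 * (24 * N * Real.exp (-(L / 128))) * (L * N) := by gcongr
      _ = 48 * N ^ 2 * ((L * Real.exp (-(L / 256))) * Real.exp (-(L / 256))) := by rw [h5]; ring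
      _ ≤ 48 * N ^ 2 * (256 * (N ^ 16)⁻¹) := by gcongr
      _ = 12288 * N ^ 2 / N ^ 16 := by ring
      _ ≤ 1 := by
          rw [div_le_one (by positivity)]
          have := hpow 14
          have h3 : 0 < N ^ 2 := by positivity
          nlinarith

end Constants

/-! ### From the rounded distribution to a standard Gaussian integral. -/

section Distribution

theorem map_smul_stdGaussianPi {σ : Type*} [Fintype σ] {v : ℝ} (hv : 0 ≤ v) :
    (stdGaussianPi σ).map (fun g => √v • g) = Measure.pi fun _ => gaussianReal 0 v.toNNReal := by
  have h : (gaussianReal 0 1).map (fun x => √v * x) = gaussianReal 0 v.toNNReal := by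
    rw [gaussianReal_map_const_mul, mul_zero, mul_one]
    congr 1
    ext
    simp [Real.sq_sqrt hv, Real.coe_toNNReal _ hv]
  have hp := Measure.pi_map_pi (ι := σ) (μ := fun _ => gaussianReal 0 1)
    (f := fun _ (x : ℝ) => √v * x) (fun _ => by fun_prop)
  simp_rw [h] at hp
  exact hp

theorem measurable_elim_sq_sub {σ : Type*} [Fintype σ] (H : Matrix σ σ ℝ) (c : ℝ) :
    Measurable fun X : σ → ℝ => Sum.elim X fun i => (H *ᵥ X) i ^ 2 - c := by
  refine measurable_pi_lambda _ fun k => ?_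
  rcases k with i | j
  · exact measurable_pi_apply i
  · exact (((measurable_pi_apply j).comp
      (by fun_prop : Measurable fun X => H *ᵥ X)).pow_const 2).sub_const _

theorem gaussianLaw_eq_map {C : ℝ} {n : ℕ} (hε : 0 ≤ eps C n) :
    gaussianLaw C n = (stdGaussianPi (Idx n)).map (interpPoint (hadamard n) √(eps C n)) := by
  rw [gaussianLaw, ← map_smul_stdGaussianPi hε, Measure.map_map]
  · congr 1
    ext g k
    rcases k with i | j
    · simp [interpPoint]
    · simp only [interpPoint, Function.comp_apply, Sum.elim_inr, Matrix.mulVec_smul,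
        Pi.smul_apply, smul_eq_mul, mul_pow, Real.sq_sqrt hε]
      ring
  · exact measurable_elim_sq_sub _ _
  · fun_prop

theorem measurable_interpPoint {σ : Type*} [Fintype σ] (H : Matrix σ σ ℝ) (s : ℝ) :
    Measurable (interpPoint H s) := by
  refine measurable_pi_lambda _ fun k => ?_
  rcases k with i | j
  · exact (measurable_pi_apply (X := fun _ : σ => ℝ) i).const_mul s
  · exact ((((measurable_pi_apply j).comp
      (by fun_prop : Measurable fun g => H *ᵥ g)).pow_const 2).sub_const 1).const_mul _

theorem measurable_multilinearExt {ι : Type*} [Fintype ι] [DecidableEq ι] (F : (ι → ℤˣ) → ℝ) :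
    Measurable (multilinearExt F) := by
  unfold multilinearExt
  fun_prop

instance {ι : Type*} [Fintype ι] : IsMarkovKernel (rounding ι) :=
  ⟨fun z => inferInstanceAs (IsProbabilityMeasure (Measure.pi fun i => roundCoord (z i)))⟩

instance (C : ℝ) (n : ℕ) : IsProbabilityMeasure (gaussianLaw C n) := by
  refine Measure.isProbabilityMeasure_map (Measurable.aemeasurable ?_)
  exact measurable_elim_sq_sub (hadamard n) (eps C n)

instance (C : ℝ) (n : ℕ) : IsProbabilityMeasure (forrelationDist C n) :=
  inferInstanceAs (IsProbabilityMeasure ((gaussianLaw C n).bind (rounding (Idx n ⊕ Idx n))))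

theorem integral_forrelationDist {C : ℝ} {n : ℕ} (hε : 0 ≤ eps C n)
    (F : (Idx n ⊕ Idx n → ℤˣ) → ℝ) :
    ∫ w, F w ∂(forrelationDist C n) = ∫ g, multilinearExt F
      (fun k => trnc (interpPoint (hadamard n) √(eps C n) g k)) ∂(stdGaussianPi (Idx n)) := by
  have hint : Integrable F (forrelationDist C n) := Integrable.of_finite
  rw [forrelationDist, Measure.comp_eq_comp_const_apply] at hint ⊢
  rw [Kernel.integral_comp hint, Kernel.const_apply]
  simp_rw [integral_rounding]
  rw [gaussianLaw_eq_map hε, integral_map (measurable_interpPoint _ _).aemeasurable]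
  refine (Measurable.comp (measurable_multilinearExt F) ?_).aestronglyMeasurable
  exact measurable_pi_lambda _ fun k => measurable_trnc.comp (measurable_pi_apply k)

theorem integrable_multilinearExt_trnc {σ : Type*} [Fintype σ] [DecidableEq σ]
    (F : (σ ⊕ σ → ℤˣ) → ℝ) (hF : ∀ x, |F x| ≤ 1) (H : Matrix σ σ ℝ) (s : ℝ) :
    Integrable (fun g => multilinearExt F fun k => trnc (interpPoint H s g k))
      (stdGaussianPi σ) := by
  refine Integrable.of_bound (C := 1) ?_ (Filter.Eventually.of_forall fun g => ?_)
  · refine (Measurable.comp (measurable_multilinearExt F) ?_).aestronglyMeasurable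
    exact measurable_pi_lambda _ fun k => measurable_trnc.comp
      ((measurable_pi_apply k).comp (measurable_interpPoint H s))
  · rw [Real.norm_eq_abs, multilinearExt_eq_partialExt]
    refine (abs_partialExt_le hF _ _).trans (le_of_eq ?_)
    exact Finset.prod_eq_one fun k _ => max_eq_left (abs_trnc_le_one _)

theorem integrable_multilinearExt_interpPoint {σ : Type*} [Fintype σ] [DecidableEq σ]
    (F : (σ ⊕ σ → ℤˣ) → ℝ) (H : Matrix σ σ ℝ) (s : ℝ) :
    Integrable (fun g => multilinearExt F (interpPoint H s g)) (stdGaussianPi σ) := by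
  simp_rw [multilinearExt, prod_interpPoint]
  exact integrable_finsetSum _ fun S _ =>
    ((integrable_eval_stdGaussianPi _).const_mul _).const_mul _

end Distribution

end SquaredForrelation

end

open SquaredForrelation in
theorem mainTheorem2 :
    ∃ C₀ : ℝ, 20 ≤ C₀ ∧ ∃ K : ℝ, 0 < K ∧
      ∀ C : ℝ, C₀ ≤ C → ∀ n : ℕ, 1 ≤ n → ∀ ℓ : ℝ, 1 ≤ ℓ →
        ∀ F : (SquaredForrelation.Idx n ⊕ SquaredForrelation.Idx n → ℤˣ) → ℝ,
          (∀ x, F x ∈ Set.Icc (-1 : ℝ) 1) →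
          (∀ ρ : SquaredForrelation.Idx n ⊕ SquaredForrelation.Idx n → Option ℤˣ,
            SquaredForrelation.levelTwoNorm (SquaredForrelation.restrict F ρ) ≤ ℓ) →
          |∫ w, (F w - SquaredForrelation.multilinearExt F 0) ∂(SquaredForrelation.forrelationDist C n)| ≤
            K * (SquaredForrelation.eps C n * ℓ / Real.sqrt (2 ^ n)) := by
  -- The constant `13` is `12 + 1`: the drift gives `4 · (2 + 1)`, its tail part being at most `1 ≤
  -- ℓ`, and truncation gives `1`.
  refine ⟨4096, by norm_num, 13, by norm_num, fun C hC n hn ℓ hℓ F hF1 hFℓ => ?_⟩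
  have hN : (2 : ℝ) ≤ 2 ^ n := by
    simpa using pow_le_pow_right₀ (one_le_two : (1 : ℝ) ≤ 2) hn
  have hlog : Real.log 2 ≤ Real.log (2 ^ n) := Real.log_le_log (by norm_num) hN
  have hL : 12 ≤ C * Real.log (2 ^ n) := by nlinarith [Real.log_two_gt_d9]
  have hLpos : 0 < C * Real.log (2 ^ n) := by linarith
  have hε : 0 < eps C n := one_div_pos.2 hLpos
  have hcard : (Fintype.card (Idx n) : ℝ) = 2 ^ n := by simp
  have hs : C * Real.log (2 ^ n) * √(eps C n) ^ 2 ≤ 1 := by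
    rw [Real.sq_sqrt hε.le, eps, mul_one_div, div_self hLpos.ne']
  have hF : ∀ x, |F x| ≤ 1 := fun x => abs_le.2 (hF1 x)
  have hH := hadamard_transpose_mul_self n
  obtain ⟨ht1, ht2⟩ := tailBound_le hC hN
  have h1 := abs_integral_trnc_sub_le hH hF hL hs
  have h2 := abs_integral_interpPoint_sub_le hH (fun i j => (abs_hadamard n i j).le)
    (by positivity) hF (by linarith) hFℓ hL (Real.sqrt_nonneg _) hs
  rw [hcard] at h1 h2
  rw [Real.sq_sqrt hε.le] at h2
  rw [integral_sub (integrable_multilinearExt_trnc _ hF _ _)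
    (integrable_multilinearExt_interpPoint _ _ _)] at h1
  rw [integral_sub Integrable.of_finite (integrable_const _), integral_forrelationDist hε.le,
    integral_const, probReal_univ, one_smul]
  have h3 : 2 * tailBound (C * Real.log (2 ^ n)) (2 ^ n) ≤ eps C n * ℓ / √(2 ^ n) := by
    refine ht2.trans ?_
    rw [eps] at hε ⊢
    gcongr
    exact le_mul_of_one_le_right hε.le hℓ
  have h4 : 4 * eps C n * (1 / √(2 ^ n) * (2 * ℓ) + 1 / √(2 ^ n) * (2 ^ n) ^ 2 *
      tailBound (C * Real.log (2 ^ n)) (2 ^ n)) ≤ 12 * (eps C n * ℓ / √(2 ^ n)) := by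
    calc _ = 4 * eps C n * (1 / √(2 ^ n)) * (2 * ℓ + (2 ^ n) ^ 2 *
          tailBound (C * Real.log (2 ^ n)) (2 ^ n)) := by ring
      _ ≤ 4 * eps C n * (1 / √(2 ^ n)) * (3 * ℓ) := by
          gcongr
          linarith
      _ = _ := by ring
  have h5 := abs_le.1 (h1.trans h3)
  have h6 := abs_le.1 (h2.trans h4)
  exact abs_le.2 ⟨by linarith, by linarith⟩
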